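/- Setting. An observation $Z$ has, conditionally on an unobserved scalar $\alpha\in\mathcal A\subseteq\mathbb R$, a known density $f_{z/\alpha}$ (jointly measurable) with respect to a $\sigma$-finite measure $\mu$. $H$ is a class of probability distributions on $\mathcal A$. If $\alpha\sim\eta\in H$, then $Z$ has law $\mathbb P_\eta$ with $\mu$-density $f_\eta(z)=\int f_{z/\alpha}(z)\,d\eta(\alpha)$. Let $\eta_0\in H$ and $\mathbb P=\mathbb P_{\eta_0}$. A path $(\eta_t)_{t\in[0,\varepsilon)}$ in $H$ starting at $\eta_0$ has score $b\in L_2(\eta_0)$ if $\int[(d\eta_t^{1/2}-d\eta_0^{1/2})/t-\tfrac12 b\,d\eta_0^{1/2}]^2\to0$ as $t\downarrow0$; scores $g\in L_2(\mathbb P)$ of the induced paths $(\mathbb P_{\eta_t})$ are defined in the same way. $T(\eta_0)$ is the linear span of all scores $b$. The heterogeneity is assumed nonparametric: $T(\eta_0)$ is dense in $L_2^0(\eta_0)$, the mean-zero functions of $L_2(\eta_0)$. A functional $\phi$ has influence function $r\in L_2^0(\eta_0)$ at $\eta_0$ if $\lim_{t\downarrow 0}(\phi(\eta_t)-\phi(\eta_0))/t=\mathbb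 E_{\eta_0}[r(\alpha)b(\alpha)]$ for every path with a score $b$. The efficiency bound of $\phi$ at $\eta_0$ is $\sup c^2/\mathbb E[g(Z)^2]$ (with $c^2/0=\infty$ if $c\neq 0$ and $0/0=0$) over the linear span of the pairs $(g,c)$, where $g$ is the score of $(\mathbb P_{\eta_t})$ and $c$ is the derivative of $\phi(\eta_t)$ at $t=0$ along a path $(\eta_t)$ that has a score. $\phi(\eta_0)$ is regularly identified if it is identified (i.e. $\eta\in H$ and $\mathbb P_\eta=\mathbb P_{\eta_0}$ imply $\phi(\eta)=\phi(\eta_0)$) and its efficiency bound is finite. Let $\tau\in(0,1)$, let $\phi(\eta)=\inf\{x:\eta((-\infty,x])\ge\tau\}$ be the $\tau$-quantile, and put $q=\phi(\eta_0)$, with $\eta_0((-\infty,q])=\tau$. Assume that in a neighborhood of $q$ the distribution $\eta_0$ has a strictly positive Lebesgue density $\dot\eta_0$, and that the distribution function of $\eta_0$ is differentiable at $q$ with derivative $\dot\eta_0(q)$ (as it is when the density is continuous at $q$). Put $$r_\phi(\alpha)=-\frac{1(\alpha<q)-\tau}{\dot\eta_0(q)} .$$ Let $N\ni q$ be an open subset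 of $\mathcal A$ such that (i) for $\mu$-almost every $z$, $\alpha\mapsto f_{z/\alpha}(z)$ is continuous on $N$; and (ii) every $\alpha\in N$ has a neighborhood $\Gamma_0\subset N$ such that $\int|s(z)|\sup_{a\in\Gamma_0}f_{z/a}(z)\,d\mu(z)<\infty$ for every measurable $s$ with $\mathbb E[s(Z)]=0$, $\mathbb E[s(Z)^2]<\infty$ and $r_\phi(\alpha)-\mathbb E_{\eta_0}[r_\phi(\alpha)]=\int s(z)f_{z/\alpha}(z)\,d\mu(z)$ for $\eta_0$-almost every $\alpha$. Then $\phi$ has influence function $r_\phi$ at $\eta_0$; $r_\phi$ is discontinuous on $N$ (no function continuous on $N$ is equal to it $\eta_0$-a.e. on $N$); the efficiency bound of $\phi$ at $\eta_0$ is infinite; and hence the $\tau$-quantile of the nonparametric heterogeneity distribution is not regularly identified. -/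

import Mathlib

open MeasureTheory ProbabilityTheory Filter Topology Set
open scoped NNReal ENNReal

/-- A nonparametric mixture model. `f α` is the known conditional density, with respect to the
σ-finite measure `μ`, of the observation `Z` given heterogeneity `α` in the set `supp`; `H` is the
class of candidate distributions of `α`, all carried by `supp`. -/
structure MixtureModel (A Z : Type*) [MeasurableSpace A] [MeasurableSpace Z] where
  μ : Measure Z
  sigmaFinite : SigmaFinite μ
  supp : Set A
  f : A → Z → ℝ≥0
  measurable_f : Measurable (Function.uncurry f)
  lintegral_f : ∀ α ∈ supp, ∫⁻ z, (f α z : ℝ≥0∞) ∂μ = 1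
  H : Set (ProbabilityMeasure A)
  carried : ∀ η ∈ H, ∀ᵐ α ∂(η : Measure A), α ∈ supp

/-- Mean-square differentiability at `t = 0`, from the right, of a path `t ↦ Q t` of measures:
`∫ [(dQ_t^{1/2} - dQ_0^{1/2}) / t - (1/2) b dQ_0^{1/2}]² → 0` as `t ↓ 0`.
The integral does not depend on the dominating measure; here it is `Q t + Q 0`. -/
def HasScore {Ω : Type*} [MeasurableSpace Ω] (Q : ℝ → Measure Ω) (b : Ω → ℝ) : Prop :=
  Tendsto
    (fun t : ℝ => ∫⁻ x, ENNReal.ofReal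
      (((√((Q t).rnDeriv (Q t + Q 0) x).toReal - √((Q 0).rnDeriv (Q t + Q 0) x).toReal) / t
        - 1 / 2 * b x * √((Q 0).rnDeriv (Q t + Q 0) x).toReal) ^ 2) ∂(Q t + Q 0))
    (𝓝[>] 0) (𝓝 0)

namespace MixtureModel

variable {A Z : Type*} [MeasurableSpace A] [MeasurableSpace Z]

/-- The law of the observation `Z` when `η` is the distribution of heterogeneity: its density with
respect to `μ` is the mixture `z ↦ ∫ f α z dη(α)`. -/
noncomputable def law (M : MixtureModel A Z) (η : ProbabilityMeasure A) : Measure Z :=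
  M.μ.withDensity (fun z => ∫⁻ α, (M.f α z : ℝ≥0∞) ∂(η : Measure A))

/-- A path in the class `H`, indexed by `t ∈ [0, ε)`, that starts at `η₀`. -/
def IsPath (M : MixtureModel A Z) (η₀ : ProbabilityMeasure A)
    (γ : ℝ → ProbabilityMeasure A) : Prop :=
  γ 0 = η₀ ∧ ∃ ε > 0, ∀ t ∈ Ico (0 : ℝ) ε, γ t ∈ M.H

/-- A path in `H` starting at `η₀` that is mean-square differentiable with score `b ∈ L₂(η₀)`. -/
def IsSubmodel (M : MixtureModel A Z) (η₀ : ProbabilityMeasure A)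
    (γ : ℝ → ProbabilityMeasure A) (b : Lp ℝ 2 (η₀ : Measure A)) : Prop :=
  M.IsPath η₀ γ ∧ HasScore (fun t => (γ t : Measure A)) b

/-- `T(η₀)`: the linear span of the scores of the mean-square differentiable paths in `H`. -/
noncomputable def tangentSpace (M : MixtureModel A Z) (η₀ : ProbabilityMeasure A) :
    Submodule ℝ (Lp ℝ 2 (η₀ : Measure A)) :=
  Submodule.span ℝ {b | ∃ γ, M.IsSubmodel η₀ γ b}

/-- Heterogeneity is nonparametric: `T(η₀)` is dense in the mean-zero functions of `L₂(η₀)`. -/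
def Nonparametric (M : MixtureModel A Z) (η₀ : ProbabilityMeasure A) : Prop :=
  ∀ h : Lp ℝ 2 (η₀ : Measure A), ∫ α, h α ∂(η₀ : Measure A) = 0 →
    h ∈ (M.tangentSpace η₀).topologicalClosure

/-- `c` is the derivative of the functional `φ` along the path `γ`, at `t = 0`. -/
def HasPathDeriv (φ : ProbabilityMeasure A → ℝ) (γ : ℝ → ProbabilityMeasure A) (c : ℝ) : Prop :=
  Tendsto (fun t : ℝ => (φ (γ t) - φ (γ 0)) / t) (𝓝[>] 0) (𝓝 c)

/-- The functional `φ` is differentiable at `η₀` with influence function `r`. -/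
def HasInfluenceFunction (M : MixtureModel A Z) (η₀ : ProbabilityMeasure A)
    (φ : ProbabilityMeasure A → ℝ) (r : A → ℝ) : Prop :=
  MemLp r 2 (η₀ : Measure A) ∧ ∫ α, r α ∂(η₀ : Measure A) = 0 ∧
    ∀ γ b, M.IsSubmodel η₀ γ b → HasPathDeriv φ γ (∫ α, r α * b α ∂(η₀ : Measure A))

/-- The linear span of the pairs `(g, c)` where, along some mean-square differentiable path in `H`,
`g` is the score of the induced path of laws of the observation `Z`, and `c` is the derivative
of `φ`. -/
noncomputable def scoreDerivSpace (M : MixtureModel A Z) (η₀ : ProbabilityMeasure A)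
    (φ : ProbabilityMeasure A → ℝ) : Submodule ℝ (Lp ℝ 2 (M.law η₀) × ℝ) :=
  Submodule.span ℝ {p | ∃ γ b, M.IsSubmodel η₀ γ b ∧
    HasScore (fun t => M.law (γ t)) p.1 ∧ HasPathDeriv φ γ p.2}

/-- The semiparametric efficiency bound for `φ` at `η₀`, from observing `Z`: the supremum of the
Cramér-Rao bounds `c² / E[g(Z)²]` over the tangent space of the model for `Z`
(with `c² / 0 = ∞` if `c ≠ 0`, and `0 / 0 = 0`). -/
noncomputable def efficiencyBound (M : MixtureModel A Z) (η₀ : ProbabilityMeasure A)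
    (φ : ProbabilityMeasure A → ℝ) : ℝ≥0∞ :=
  ⨆ p ∈ M.scoreDerivSpace η₀ φ, ENNReal.ofReal (p.2 ^ 2) / ENNReal.ofReal (‖p.1‖ ^ 2)

/-- `φ(η₀)` is identified from the law of `Z`. -/
def Identified (M : MixtureModel A Z) (η₀ : ProbabilityMeasure A)
    (φ : ProbabilityMeasure A → ℝ) : Prop :=
  ∀ η ∈ M.H, M.law η = M.law η₀ → φ η = φ η₀

/-- Regular identification: identification with a finite efficiency bound. -/
def RegularlyIdentified (M : MixtureModel A Z) (η₀ : ProbabilityMeasure A)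
    (φ : ProbabilityMeasure A → ℝ) : Prop :=
  M.Identified η₀ φ ∧ M.efficiencyBound η₀ φ < ⊤

/-- `s` is a measurable function of `Z` with zero mean and finite variance that satisfies
`r(α) - E[r(α)] = ∫ s(z) f(z | α) dμ(z)`, `η₀`-almost surely. -/
def SolvesScoreEq (M : MixtureModel A Z) (η₀ : ProbabilityMeasure A) (r : A → ℝ) (s : Z → ℝ) :
    Prop :=
  Measurable s ∧ MemLp s 2 (M.law η₀) ∧ ∫ z, s z ∂(M.law η₀) = 0 ∧
    ∀ᵐ α ∂(η₀ : Measure A),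
      r α - ∫ a, r a ∂(η₀ : Measure A) = ∫ z, s z * (M.f α z : ℝ) ∂M.μ

/-- The smoothness assumption on the conditional density, on a subset `N` of `supp`:
continuity in `α`, and local domination for every solution of the score equation for `r`. -/
structure SmoothOn [TopologicalSpace A] (M : MixtureModel A Z) (η₀ : ProbabilityMeasure A)
    (r : A → ℝ) (N : Set A) : Prop where
  continuousOn : ∀ᵐ z ∂M.μ, ContinuousOn (fun α => M.f α z) N
  dominated : ∀ α ∈ N, ∃ Γ ∈ 𝓝[N] α, Γ ⊆ N ∧ ∀ s, M.SolvesScoreEq η₀ r s →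
    ∫⁻ z, ‖s z‖ₑ * (⨆ a ∈ Γ, (M.f a z : ℝ≥0∞)) ∂M.μ < ⊤

end MixtureModel

/-- The `τ`-quantile of a distribution on the line, `inf {x | F(x) ≥ τ}`. -/
noncomputable def quantile (τ : ℝ) (η : ProbabilityMeasure ℝ) : ℝ :=
  sInf {x : ℝ | τ ≤ cdf (η : Measure ℝ) x}

/-- The influence function `-(1(α < q) - τ) / d` of the `τ`-quantile `q`, where `d` is the density
at `q`. -/
noncomputable def quantileInfluence (τ q d : ℝ) (α : ℝ) : ℝ :=
  -((Iio q).indicator (fun _ => (1 : ℝ)) α - τ) / d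

/-!
The quantile has a discontinuous influence function, while a functional with a finite efficiency
bound must have an influence function in the range of the adjoint of the score operator, and that
range consists of functions that are continuous on `N`.

*Influence function.* A path with score `b` satisfies `η_t(B) = η₀(B) + t ∫_B b dη₀ + o(t)`
uniformly in the set `B` (`abs_measureReal_sub_le`). Evaluated at half-lines that end at `q + t m`,
this shows on which side of `τ` the distribution function of `η_t` lies there, so the quantile of
`η_t` is `q - t (∫_{(-∞, q]} b dη₀) / p(q) + o(t)` (`hasPathDeriv_quantile`).

*Scores of the observation.* The square root of the mixture density at `z` is the norm of
`√dη_t` in the `L²` space weighted by the likelihood `f α z`. Differentiating the norm, with an error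
bound that survives where the mixture density is small (`sq_norm_sub_norm_div_le`), and integrating
over `z` gives: the laws of `Z` along the path have score `E[b | Z]`
(`MixtureModel.IsSubmodel.hasScore_law`).

*Finite bound.* If the efficiency bound is finite, then the derivative of the functional is a bounded
linear function of the score of `Z`, so by Hahn–Banach and Riesz it is the inner product with some
`s ∈ L²`. Hence `∫ r b dη₀ = E[s(Z) E[b | Z]] = ∫ E[s(Z) | α] b(α) dη₀` for all scores `b`. These
span a dense subspace of the mean-zero functions, so `r(α) = E[s(Z) | α]` almost surely
(`MixtureModel.exists_solvesScoreEq`). By dominated convergence the right-hand side is continuous on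
`N` (`MixtureModel.SmoothOn.continuousOn_adjointScore`), whereas `r` jumps at `q`, where `η₀` charges
both sides (`not_exists_continuousOn_eq_quantileInfluence`).
-/

/-! ### Square-integrable functions -/

section SquareIntegrable

variable {Ω : Type*} [MeasurableSpace Ω] {ν : Measure Ω}

lemma inner_toLp_toLp {φ ψ : Ω → ℝ} (hφ : MemLp φ 2 ν) (hψ : MemLp ψ 2 ν) :
    inner ℝ (hφ.toLp φ) (hψ.toLp ψ) = ∫ x, φ x * ψ x ∂ν := by
  rw [L2.inner_def]
  refine integral_congr_ae ?_
  filter_upwards [hφ.coeFn_toLp, hψ.coeFn_toLp] with x h1 h2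
  simp [h1, h2, mul_comm]

lemma norm_toLp_sq {φ : Ω → ℝ} (hφ : MemLp φ 2 ν) :
    ‖hφ.toLp φ‖ ^ 2 = ∫ x, φ x ^ 2 ∂ν := by
  rw [← real_inner_self_eq_norm_sq, inner_toLp_toLp]
  simp [pow_two]

lemma ofReal_norm_toLp_sq {φ : Ω → ℝ} (hφ : MemLp φ 2 ν) :
    ENNReal.ofReal (‖hφ.toLp φ‖ ^ 2) = ∫⁻ x, ENNReal.ofReal (φ x ^ 2) ∂ν := by
  rw [norm_toLp_sq, ofReal_integral_eq_lintegral_ofReal hφ.integrable_sq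
    (Eventually.of_forall fun x => sq_nonneg _)]

lemma memLp_two_of_lintegral_lt_top {φ : Ω → ℝ} (hφ : AEStronglyMeasurable φ ν)
    (h : ∫⁻ x, ENNReal.ofReal (φ x ^ 2) ∂ν < ⊤) : MemLp φ 2 ν := by
  rw [memLp_two_iff_integrable_sq hφ]
  refine ⟨hφ.pow 2, ?_⟩
  rw [hasFiniteIntegral_iff_ofReal (Eventually.of_forall fun x => sq_nonneg _)]
  exact h

/-- Cauchy–Schwarz on a measurable set. -/
lemma abs_setIntegral_mul_le {φ ψ : Ω → ℝ} (hφ : MemLp φ 2 ν) (hψ : MemLp ψ 2 ν)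
    {B : Set Ω} (hB : MeasurableSet B) :
    |∫ x in B, φ x * ψ x ∂ν| ≤ ‖hφ.toLp φ‖ * ‖hψ.toLp ψ‖ := by
  have hi : MemLp (B.indicator ψ) 2 ν := hψ.indicator hB
  have h1 : ∫ x in B, φ x * ψ x ∂ν = inner ℝ (hφ.toLp φ) (hi.toLp _) := by
    rw [inner_toLp_toLp, ← integral_indicator hB]
    congr 1; ext x; by_cases hx : x ∈ B <;> simp [hx]
  rw [h1]
  refine (abs_real_inner_le_norm _ _).trans ?_
  gcongr
  rw [Lp.norm_toLp, Lp.norm_toLp]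
  exact ENNReal.toReal_mono hψ.eLpNorm_ne_top (eLpNorm_indicator_le _)

/-- If `u - v ≈ t w / 2` in `L²`, then `u² - v² ≈ t w v` in `L¹`, with an explicit error. -/
lemma abs_setIntegral_sq_sub_sq_le {u v w : Ω → ℝ} (hu : MemLp u 2 ν) (hv : MemLp v 2 ν)
    (hw : MemLp w 2 ν) {t : ℝ} (ht : 0 < t)
    (hR : MemLp (fun x => (u x - v x) / t - 1 / 2 * w x) 2 ν)
    (hu1 : ‖hu.toLp u‖ ≤ 1) (hv1 : ‖hv.toLp v‖ ≤ 1) {B : Set Ω} (hB : MeasurableSet B) :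
    |∫ x in B, ((u x ^ 2 - v x ^ 2) / t - w x * v x) ∂ν| ≤
      1 / 2 * ‖hw.toLp w‖ * (t * (1 / 2 * ‖hw.toLp w‖ + ‖hR.toLp _‖)) + ‖hR.toLp _‖ * 2 := by
  have hD : MemLp (fun x => u x - v x) 2 ν := hu.sub hv
  have hS : MemLp (fun x => u x + v x) 2 ν := hu.add hv
  have hDn : ‖hD.toLp _‖ ≤ t * (1 / 2 * ‖hw.toLp w‖ + ‖hR.toLp _‖) := by
    have : hD.toLp _ = t • ((1 / 2 : ℝ) • hw.toLp w + hR.toLp _) := by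
      rw [← MemLp.toLp_const_smul, ← MemLp.toLp_add, ← MemLp.toLp_const_smul]
      congr 1; ext x
      simp
      field_simp
    rw [this, norm_smul, Real.norm_of_nonneg ht.le]
    gcongr
    refine (norm_add_le _ _).trans_eq ?_
    rw [norm_smul]; norm_num
  have hSn : ‖hS.toLp _‖ ≤ 2 := by
    have : hS.toLp _ = hu.toLp u + hv.toLp v := (MemLp.toLp_add hu hv)
    rw [this]
    linarith [norm_add_le (hu.toLp u) (hv.toLp v)]
  have hid : ∫ x in B, ((u x ^ 2 - v x ^ 2) / t - w x * v x) ∂ν =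
      1 / 2 * (∫ x in B, w x * (u x - v x) ∂ν) +
      ∫ x in B, ((u x - v x) / t - 1 / 2 * w x) * (u x + v x) ∂ν := by
    rw [← integral_const_mul, ← integral_add]
    · congr 1; ext x; field_simp; ring
    · exact ((hw.integrable_mul hD).integrableOn).const_mul _
    · exact (hR.integrable_mul hS).integrableOn
  rw [hid]
  refine (abs_add_le _ _).trans (add_le_add ?_ ?_)
  · rw [abs_mul, abs_of_pos (by norm_num : (0:ℝ) < 1 / 2), mul_assoc]
    gcongr
    exact (abs_setIntegral_mul_le hw hD hB).trans (by gcongr)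
  · exact (abs_setIntegral_mul_le hR hS hB).trans (by gcongr)

end SquareIntegrable

/-! ### First-order expansion of probabilities along a path with a score -/

section Score

variable {Ω : Type*} [MeasurableSpace Ω]

/-- The square root `√(dQ/dν)` of a density. -/
noncomputable def sqrtDensity (Q ν : Measure Ω) (x : Ω) : ℝ := √(Q.rnDeriv ν x).toReal

lemma measurable_sqrtDensity (Q ν : Measure Ω) : Measurable (sqrtDensity Q ν) :=
  (Measure.measurable_rnDeriv Q ν).ennreal_toReal.sqrt

lemma sqrtDensity_sq (Q ν : Measure Ω) (x : Ω) :
    sqrtDensity Q ν x ^ 2 = (Q.rnDeriv ν x).toReal :=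
  Real.sq_sqrt ENNReal.toReal_nonneg

lemma memLp_sqrtDensity (Q ν : Measure Ω) [IsFiniteMeasure Q] :
    MemLp (sqrtDensity Q ν) 2 ν := by
  rw [memLp_two_iff_integrable_sq (measurable_sqrtDensity Q ν).aestronglyMeasurable]
  simp only [sqrtDensity_sq]
  exact Measure.integrable_toReal_rnDeriv

lemma integral_mul_sqrtDensity_sq {Q ν : Measure Ω} [IsFiniteMeasure Q] [IsFiniteMeasure ν]
    (h : Q ≪ ν) (b : Ω → ℝ) {B : Set Ω} (hB : MeasurableSet B) :
    ∫ x in B, b x * sqrtDensity Q ν x ^ 2 ∂ν = ∫ x in B, b x ∂Q := by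
  rw [← setIntegral_rnDeriv_smul h hB]
  simp [sqrtDensity_sq, mul_comm]

lemma integrable_mul_sqrtDensity_sq {Q ν : Measure Ω} [IsFiniteMeasure Q] [IsFiniteMeasure ν]
    (h : Q ≪ ν) {b : Ω → ℝ} (hb : Integrable b Q) :
    Integrable (fun x => b x * sqrtDensity Q ν x ^ 2) ν := by
  refine ((integrable_rnDeriv_smul_iff h).2 hb).congr (Eventually.of_forall fun x => ?_)
  simp [sqrtDensity_sq, mul_comm]

lemma memLp_mul_sqrtDensity {Q ν : Measure Ω} [IsFiniteMeasure Q] [IsFiniteMeasure ν]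
    (h : Q ≪ ν) {b : Ω → ℝ} (hbm : Measurable b) (hb : MemLp b 2 Q) :
    MemLp (fun x => b x * sqrtDensity Q ν x) 2 ν := by
  have hm : Measurable (fun x => b x * sqrtDensity Q ν x) := hbm.mul (measurable_sqrtDensity Q ν)
  rw [memLp_two_iff_integrable_sq hm.aestronglyMeasurable]
  simp only [mul_pow]
  exact integrable_mul_sqrtDensity_sq h hb.integrable_sq

/-- The squared Hellinger-type remainder whose vanishing as `t ↓ 0` defines the score `b`. -/
noncomputable def scoreError (t : ℝ) (Q Q₀ : Measure Ω) (b : Ω → ℝ) : ℝ≥0∞ :=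
  ∫⁻ x, ENNReal.ofReal (((sqrtDensity Q (Q + Q₀) x - sqrtDensity Q₀ (Q + Q₀) x) / t
    - 1 / 2 * (b x * sqrtDensity Q₀ (Q + Q₀) x)) ^ 2) ∂(Q + Q₀)

lemma hasScore_iff {Q : ℝ → Measure Ω} {b : Ω → ℝ} :
    HasScore Q b ↔ Tendsto (fun t => scoreError t (Q t) (Q 0) b) (𝓝[>] 0) (𝓝 0) := by
  simp only [HasScore, scoreError, sqrtDensity, mul_assoc]

lemma absolutelyContinuous_add_left (Q Q₀ : Measure Ω) : Q ≪ Q + Q₀ :=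
  Measure.absolutelyContinuous_of_le (Measure.le_add_right le_rfl)

lemma absolutelyContinuous_add_right (Q Q₀ : Measure Ω) : Q₀ ≪ Q + Q₀ :=
  Measure.absolutelyContinuous_of_le (Measure.le_add_left le_rfl)

lemma norm_toLp_sqrtDensity {Q ν : Measure Ω} [IsProbabilityMeasure Q] [IsFiniteMeasure ν]
    (h : Q ≪ ν) : ‖(memLp_sqrtDensity Q ν).toLp _‖ = 1 := by
  have h1 := norm_toLp_sq (memLp_sqrtDensity Q ν)
  have h2 := integral_mul_sqrtDensity_sq h (fun _ => (1 : ℝ)) MeasurableSet.univ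
  simp only [one_mul, Measure.restrict_univ] at h2
  rw [h2] at h1
  simp only [integral_const, probReal_univ, smul_eq_mul, mul_one] at h1
  exact (pow_eq_one_iff_of_nonneg (norm_nonneg _) two_ne_zero).1 h1

/-- Quantitative first-order expansion of the probability of a set. -/
lemma abs_measureReal_sub_le {Q Q₀ : Measure Ω} [IsProbabilityMeasure Q] [IsProbabilityMeasure Q₀]
    {b : Ω → ℝ} (hbm : Measurable b) (hb : MemLp b 2 Q₀) {t : ℝ} (ht : 0 < t)
    {B : Set Ω} (hB : MeasurableSet B) :
    |(Q.real B - Q₀.real B) / t - ∫ x in B, b x ∂Q₀| ≤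
      1 / 2 * ‖hb.toLp b‖ * (t * (1 / 2 * ‖hb.toLp b‖ + √(scoreError t Q Q₀ b).toReal))
        + √(scoreError t Q Q₀ b).toReal * 2 := by
  have hQ := absolutelyContinuous_add_left Q Q₀
  have hQ₀ := absolutelyContinuous_add_right Q Q₀
  have hu := memLp_sqrtDensity Q (Q + Q₀)
  have hv := memLp_sqrtDensity Q₀ (Q + Q₀)
  have hw := memLp_mul_sqrtDensity hQ₀ hbm hb
  have hR : MemLp (fun x => (sqrtDensity Q (Q + Q₀) x - sqrtDensity Q₀ (Q + Q₀) x) / t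
      - 1 / 2 * (b x * sqrtDensity Q₀ (Q + Q₀) x)) 2 (Q + Q₀) := by
    have := ((hu.sub hv).const_mul (t⁻¹)).sub (hw.const_mul (1 / 2))
    refine this.ae_eq (Eventually.of_forall fun x => ?_)
    simp [div_eq_inv_mul]
  have hwn : ‖hw.toLp _‖ = ‖hb.toLp b‖ := by
    rw [← sq_eq_sq₀ (norm_nonneg _) (norm_nonneg _), norm_toLp_sq, norm_toLp_sq]
    have := integral_mul_sqrtDensity_sq hQ₀ (fun x => b x ^ 2) MeasurableSet.univ
    simpa [mul_pow] using this
  have hRn : ‖hR.toLp _‖ = √(scoreError t Q Q₀ b).toReal := by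
    rw [scoreError, ← ofReal_norm_toLp_sq hR, ENNReal.toReal_ofReal (sq_nonneg _),
      Real.sqrt_sq (norm_nonneg _)]
  have key := abs_setIntegral_sq_sub_sq_le hu hv hw ht hR (norm_toLp_sqrtDensity hQ).le
    (norm_toLp_sqrtDensity hQ₀).le hB
  rw [hwn, hRn] at key
  convert key using 2
  have e1 := integral_mul_sqrtDensity_sq hQ (fun _ => (1 : ℝ)) hB
  have e2 := integral_mul_sqrtDensity_sq hQ₀ (fun _ => (1 : ℝ)) hB
  have e3 := integral_mul_sqrtDensity_sq hQ₀ b hB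
  simp only [one_mul, integral_const, MeasurableSet.univ, measureReal_restrict_apply, univ_inter,
    smul_eq_mul, mul_one] at e1 e2
  have hui := hu.integrable_sq.integrableOn (s := B)
  have hvi := hv.integrable_sq.integrableOn (s := B)
  rw [integral_sub, integral_div, integral_sub hui hvi, e1, e2, ← e3]
  · simp only [pow_two, mul_assoc]
  · exact (hui.sub hvi).div_const t
  · exact (hw.integrable_mul hv).integrableOn

/-- Along a path with score `b`, `(Q_t(B) - Q_0(B)) / t` approaches `∫_B b dQ_0`, even for a set `B`
that moves with `t`. -/
lemma HasScore.tendsto_measureReal_sub {Q : ℝ → Measure Ω} [∀ t, IsProbabilityMeasure (Q t)]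
    {b : Ω → ℝ} (h : HasScore Q b) (hbm : Measurable b) (hb : MemLp b 2 (Q 0))
    {B : ℝ → Set Ω} (hB : ∀ t, MeasurableSet (B t)) :
    Tendsto (fun t => ((Q t).real (B t) - (Q 0).real (B t)) / t - ∫ x in B t, b x ∂(Q 0))
      (𝓝[>] 0) (𝓝 0) := by
  rw [hasScore_iff] at h
  have hρ : Tendsto (fun t => √(scoreError t (Q t) (Q 0) b).toReal) (𝓝[>] 0) (𝓝 0) := by
    have := (ENNReal.tendsto_toReal (by simp : (0 : ℝ≥0∞) ≠ ⊤)).comp h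
    simpa using this.sqrt
  have ht : Tendsto (fun t : ℝ => t) (𝓝[>] 0) (𝓝 0) := tendsto_id.mono_left nhdsWithin_le_nhds
  rw [tendsto_zero_iff_abs_tendsto_zero]
  have hlim := ((ht.mul (hρ.const_add (1 / 2 * ‖hb.toLp b‖))).const_mul
    (1 / 2 * ‖hb.toLp b‖)).add (hρ.mul_const 2)
  simp only [zero_mul, mul_zero, add_zero] at hlim
  refine squeeze_zero' (Eventually.of_forall fun _ => abs_nonneg _) ?_ hlim
  filter_upwards [self_mem_nhdsWithin] with t ht
  exact abs_measureReal_sub_le hbm hb ht (hB t)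

lemma HasScore.integral_eq_zero {Q : ℝ → Measure Ω} [∀ t, IsProbabilityMeasure (Q t)]
    {b : Ω → ℝ} (h : HasScore Q b) (hbm : Measurable b) (hb : MemLp b 2 (Q 0)) :
    ∫ x, b x ∂(Q 0) = 0 := by
  have := h.tendsto_measureReal_sub hbm hb (B := fun _ => univ) (fun _ => MeasurableSet.univ)
  simp only [probReal_univ, sub_self, zero_div, Measure.restrict_univ, zero_sub] at this
  exact neg_eq_zero.1 (tendsto_nhds_unique tendsto_const_nhds this)

end Score

/-! ### The derivative of a quantile along a path -/

section Quantile

lemma quantile_le {τ : ℝ} (hτ : 0 < τ) (η : ProbabilityMeasure ℝ) {x : ℝ}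
    (h : τ ≤ cdf (η : Measure ℝ) x) : quantile τ η ≤ x := by
  refine csInf_le ?_ h
  obtain ⟨y, hy⟩ := ((tendsto_cdf_atBot (η : Measure ℝ)).eventually (gt_mem_nhds hτ)).exists
  refine ⟨y, fun z hz => ?_⟩
  by_contra hlt
  exact absurd (hz.trans (monotone_cdf _ (not_le.1 hlt).le)) (not_le.2 hy)

lemma le_quantile {τ : ℝ} (hτ : τ < 1) (η : ProbabilityMeasure ℝ) {x : ℝ}
    (h : cdf (η : Measure ℝ) x < τ) : x ≤ quantile τ η := by
  obtain ⟨y, hy⟩ := ((tendsto_cdf_atTop (η : Measure ℝ)).eventually (lt_mem_nhds hτ)).exists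
  refine le_csInf ⟨y, hy.le⟩ fun z hz => ?_
  by_contra hlt
  exact absurd (hz.trans (monotone_cdf _ (not_le.1 hlt).le)) (not_le.2 h)

/-- A distribution whose distribution function is differentiable at `q` has no atom there. -/
lemma measure_singleton_eq_zero_of_hasDerivAt_cdf (η : ProbabilityMeasure ℝ) {q d : ℝ}
    (h : HasDerivAt (fun x => cdf (η : Measure ℝ) x) d q) : (η : Measure ℝ) {q} = 0 := by
  have h1 : (cdf (η : Measure ℝ)).measure {q} = 0 := by
    rw [StieltjesFunction.measure_singleton,
      leftLim_eq_of_tendsto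
        (h.continuousAt.tendsto.mono_left nhdsWithin_le_nhds)]
    simp
  rwa [measure_cdf] at h1

/-- Integrals over half-lines vary continuously at a point that is not an atom. -/
lemma tendsto_setIntegral_Iic {η : Measure ℝ} {b : ℝ → ℝ} (hb : Integrable b η) {q : ℝ}
    (hq : η {q} = 0) {l : Filter ℝ} [l.IsCountablyGenerated] {x : ℝ → ℝ} (hx : Tendsto x l (𝓝 q)) :
    Tendsto (fun t => ∫ a in Iic (x t), b a ∂η) l (𝓝 (∫ a in Iic q, b a ∂η)) := by
  simp only [← integral_indicator measurableSet_Iic]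
  refine tendsto_integral_filter_of_dominated_convergence (fun a => ‖b a‖) ?_ ?_ hb.norm ?_
  · exact Eventually.of_forall fun t => hb.1.indicator measurableSet_Iic
  · exact Eventually.of_forall fun t => Eventually.of_forall fun a => norm_indicator_le_norm_self _ _
  · have : ∀ᵐ a ∂η, a ≠ q := by rw [ae_iff]; simpa using hq
    filter_upwards [this] with a ha
    refine tendsto_const_nhds.congr' ?_
    rcases lt_or_gt_of_ne ha with h | h
    · filter_upwards [hx.eventually (lt_mem_nhds h)] with t ht
      simp [h.le, ht.le]
    · filter_upwards [hx.eventually (gt_mem_nhds h)] with t ht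
      simp [h, ht]

/-- First-order expansion of the distribution function of `γ t` at a point that approaches the
quantile `q` of `γ 0` linearly in `t`. -/
lemma tendsto_cdf_sub_div {γ : ℝ → ProbabilityMeasure ℝ} {b : ℝ → ℝ}
    (h : HasScore (fun t => (γ t : Measure ℝ)) b) (hbm : Measurable b)
    (hb : MemLp b 2 (γ 0 : Measure ℝ)) {q d : ℝ}
    (hd : HasDerivAt (fun x => cdf (γ 0 : Measure ℝ) x) d q) (m : ℝ) :
    Tendsto (fun t => (cdf (γ t : Measure ℝ) (q + t * m) - cdf (γ 0 : Measure ℝ) q) / t)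
      (𝓝[>] 0) (𝓝 (d * m + ∫ a in Iic q, b a ∂(γ 0 : Measure ℝ))) := by
  have hlin : HasDerivAt (fun t : ℝ => q + t * m) m 0 := by
    simpa using ((hasDerivAt_id (0 : ℝ)).mul_const m).const_add q
  have hx : Tendsto (fun t : ℝ => q + t * m) (𝓝[>] 0) (𝓝 q) := by
    have := hlin.continuousAt.tendsto.mono_left (nhdsWithin_le_nhds (s := Ioi 0))
    simpa using this
  have h1 := h.tendsto_measureReal_sub hbm hb (B := fun t => Iic (q + t * m))
    (fun _ => measurableSet_Iic)
  have h2 := tendsto_setIntegral_Iic (hb.integrable one_le_two)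
    (measure_singleton_eq_zero_of_hasDerivAt_cdf _ hd) hx
  have h3 : Tendsto (fun t => (cdf (γ 0 : Measure ℝ) (q + t * m) - cdf (γ 0 : Measure ℝ) q) / t)
      (𝓝[>] 0) (𝓝 (d * m)) := by
    have hc : HasDerivAt (fun t : ℝ => cdf (γ 0 : Measure ℝ) (q + t * m)) (d * m) 0 := by
      have hd' : HasDerivAt (fun x => cdf (γ 0 : Measure ℝ) x) d (q + 0 * m) := by simpa using hd
      exact hd'.comp (0 : ℝ) hlin
    have := (hasDerivAt_iff_tendsto_slope.1 hc).mono_left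
      (nhdsWithin_mono (0 : ℝ) (fun t (ht : 0 < t) => ht.ne'))
    refine this.congr fun t => ?_
    simp [slope_def_field]
  have := (h1.add h2).add h3
  simp only [zero_add] at this
  rw [add_comm (d * m)]
  refine this.congr fun t => ?_
  simp only [cdf_eq_real]
  ring

/-- Along a path with score `b`, the derivative of the `τ`-quantile is
`-(∫_{(-∞, q]} b dη₀) / d`, `d` being the derivative of the distribution function at `q`. -/
lemma hasPathDeriv_quantile {γ : ℝ → ProbabilityMeasure ℝ} {b : ℝ → ℝ}
    (h : HasScore (fun t => (γ t : Measure ℝ)) b) (hbm : Measurable b)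
    (hb : MemLp b 2 (γ 0 : Measure ℝ)) {τ q d : ℝ} (hτ : τ ∈ Ioo (0 : ℝ) 1)
    (hq : q = quantile τ (γ 0)) (hqτ : cdf (γ 0 : Measure ℝ) q = τ) (hd0 : 0 < d)
    (hd : HasDerivAt (fun x => cdf (γ 0 : Measure ℝ) x) d q) :
    MixtureModel.HasPathDeriv (quantile τ) γ (-(∫ a in Iic q, b a ∂(γ 0 : Measure ℝ)) / d) := by
  have key := tendsto_cdf_sub_div h hbm hb hd
  set I := ∫ a in Iic q, b a ∂(γ 0 : Measure ℝ)
  unfold MixtureModel.HasPathDeriv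
  rw [tendsto_order, ← hq]
  constructor
  · intro m hm
    -- choose `m < m' < -I / d`: at `q + t m'` the distribution function is still below `τ`
    obtain ⟨m', hm1, hm2⟩ := exists_between hm
    have hneg : d * m' + I < 0 := by rw [lt_div_iff₀ hd0] at hm2; linarith
    filter_upwards [(key m').eventually (gt_mem_nhds hneg), self_mem_nhdsWithin] with t ht ht0
    have ht0 : 0 < t := ht0
    rw [hqτ, div_lt_iff₀ ht0, zero_mul, sub_neg] at ht
    have := le_quantile hτ.2 _ ht
    rw [lt_div_iff₀ ht0]
    nlinarith
  · intro m hm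
    obtain ⟨m', hm1, hm2⟩ := exists_between hm
    have hpos : 0 < d * m' + I := by rw [div_lt_iff₀ hd0] at hm1; linarith
    filter_upwards [(key m').eventually (lt_mem_nhds hpos), self_mem_nhdsWithin] with t ht ht0
    have ht0 : 0 < t := ht0
    rw [hqτ, lt_div_iff₀ ht0, zero_mul, sub_pos] at ht
    have := quantile_le hτ.1 _ ht.le
    rw [div_lt_iff₀ ht0]
    nlinarith

end Quantile

/-! ### Differentiation of the norm of a Hilbert space -/

section NormDerivative

variable {E : Type*} [NormedAddCommGroup E] [InnerProductSpace ℝ E]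

/-- The normalized vectors `(x + y) / (‖x‖ + ‖y‖)` and `y / ‖y‖` are close when `x` is close
to `y`. -/
lemma norm_smul_add_sub_smul_le (x : E) {y : E} (hy : y ≠ 0) :
    ‖(‖x‖ + ‖y‖)⁻¹ • (x + y) - ‖y‖⁻¹ • y‖ ≤ 2 * min 1 (‖x - y‖ / ‖y‖) := by
  have hy0 : 0 < ‖y‖ := norm_pos_iff.2 hy
  have hn : 0 < ‖x‖ + ‖y‖ := by positivity
  rw [mul_min_of_nonneg _ _ zero_le_two, le_min_iff]
  constructor
  · refine (norm_sub_le _ _).trans ?_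
    rw [norm_smul, norm_smul, norm_inv, norm_inv, norm_norm, Real.norm_of_nonneg hn.le,
      inv_mul_cancel₀ hy0.ne', inv_mul_eq_div]
    have := (div_le_one hn).2 (norm_add_le x y)
    linarith
  · have h1 : (‖x‖ + ‖y‖)⁻¹ • (x + y) - ‖y‖⁻¹ • y =
        (‖x‖ + ‖y‖)⁻¹ • ((x - y) + ((‖y‖ - ‖x‖) / ‖y‖) • y) := by
      match_scalars <;> field_simp
      ring
    have h2 : ‖((‖y‖ - ‖x‖) / ‖y‖) • y‖ ≤ ‖x - y‖ := by
      rw [norm_smul, norm_div, norm_norm, div_mul_cancel₀ _ hy0.ne', norm_sub_rev x y]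
      exact abs_norm_sub_norm_le y x
    rw [h1, norm_smul, norm_inv, Real.norm_of_nonneg hn.le, inv_mul_eq_div, ← mul_div_assoc]
    have := norm_add_le (x - y) (((‖y‖ - ‖x‖) / ‖y‖) • y)
    gcongr
    · linarith
    · linarith [norm_nonneg x]

/-- If `x ≈ y + t h / 2`, then `‖x‖ ≈ ‖y‖ + t ⟨h, y⟩ / (2 ‖y‖)`. The error does not blow up as `y`
gets small. -/
lemma abs_norm_sub_norm_div_le (x y h : E) {t : ℝ} (ht : 0 < t) (hyh : y = 0 → h = 0) :
    |(‖x‖ - ‖y‖) / t - 1 / 2 * (inner ℝ h y / ‖y‖)| ≤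
      ‖t⁻¹ • (x - y) - (1 / 2 : ℝ) • h‖ + ‖h‖ * min 1 (‖x - y‖ / ‖y‖) := by
  by_cases hy : y = 0
  · simp [hy, hyh hy, norm_smul, abs_of_pos ht, div_eq_inv_mul]
  have hy0 : 0 < ‖y‖ := norm_pos_iff.2 hy
  have hn : 0 < ‖x‖ + ‖y‖ := by positivity
  have hid : (‖x‖ - ‖y‖) / t - 1 / 2 * (inner ℝ h y / ‖y‖) =
      inner ℝ (t⁻¹ • (x - y) - (1 / 2 : ℝ) • h) ((‖x‖ + ‖y‖)⁻¹ • (x + y)) +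
      1 / 2 * inner ℝ h ((‖x‖ + ‖y‖)⁻¹ • (x + y) - ‖y‖⁻¹ • y) := by
    simp only [inner_sub_left, inner_sub_right, inner_add_right, inner_smul_left, inner_smul_right,
      real_inner_self_eq_norm_sq, real_inner_comm x y, conj_trivial]
    field_simp
    ring
  rw [hid]
  refine (abs_add_le _ _).trans (add_le_add ?_ ?_)
  · refine (abs_real_inner_le_norm _ _).trans (mul_le_of_le_one_right (norm_nonneg _) ?_)
    rw [norm_smul, norm_inv, Real.norm_of_nonneg hn.le, inv_mul_eq_div, div_le_one hn]
    exact norm_add_le x y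
  · rw [abs_mul, abs_of_pos (by norm_num : (0 : ℝ) < 1 / 2)]
    have h1 := abs_real_inner_le_norm h ((‖x‖ + ‖y‖)⁻¹ • (x + y) - ‖y‖⁻¹ • y)
    have h2 := mul_le_mul_of_nonneg_left (norm_smul_add_sub_smul_le x hy) (norm_nonneg h)
    linarith

/-- Truncated form of the square of `abs_norm_sub_norm_div_le`: the ratio `‖h‖ / ‖y‖` is split at
the level `√K`. -/
lemma sq_norm_sub_norm_div_le (x y h : E) {t : ℝ} (ht : 0 < t) (hyh : y = 0 → h = 0) {K : ℝ}
    (hK : 0 ≤ K) :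
    ((‖x‖ - ‖y‖) / t - 1 / 2 * (inner ℝ h y / ‖y‖)) ^ 2 ≤
      2 * ‖t⁻¹ • (x - y) - (1 / 2 : ℝ) • h‖ ^ 2 +
        2 * (K * ‖x - y‖ ^ 2 + if K * ‖y‖ ^ 2 < ‖h‖ ^ 2 then ‖h‖ ^ 2 else 0) := by
  have h1 := sq_le_sq' (by
    have := abs_nonneg ((‖x‖ - ‖y‖) / t - 1 / 2 * (inner ℝ h y / ‖y‖))
    linarith [abs_norm_sub_norm_div_le x y h ht hyh]) (abs_norm_sub_norm_div_le x y h ht hyh)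
  rw [sq_abs] at h1
  refine h1.trans ((add_sq_le).trans ?_)
  rw [mul_add]
  gcongr
  have hm0 : 0 ≤ min 1 (‖x - y‖ / ‖y‖) := by positivity
  split_ifs with hc
  · have : (‖h‖ * min 1 (‖x - y‖ / ‖y‖)) ^ 2 ≤ ‖h‖ ^ 2 := by
      gcongr
      exact mul_le_of_le_one_right (norm_nonneg _) (min_le_left _ _)
    have : 0 ≤ K * ‖x - y‖ ^ 2 := by positivity
    linarith
  · rw [add_zero]
    by_cases hy : y = 0
    · rw [hyh hy, norm_zero, zero_mul, zero_pow two_ne_zero]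
      exact mul_nonneg hK (sq_nonneg _)
    have hy0 : 0 < ‖y‖ := norm_pos_iff.2 hy
    calc (‖h‖ * min 1 (‖x - y‖ / ‖y‖)) ^ 2 ≤ (‖h‖ * (‖x - y‖ / ‖y‖)) ^ 2 := by
          gcongr
          exact min_le_right _ _
      _ = ‖h‖ ^ 2 * ‖x - y‖ ^ 2 / ‖y‖ ^ 2 := by field_simp
      _ ≤ K * ‖y‖ ^ 2 * ‖x - y‖ ^ 2 / ‖y‖ ^ 2 := by
          gcongr
          exact not_lt.1 hc
      _ = K * ‖x - y‖ ^ 2 := by field_simp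

end NormDerivative

/-! ### Change of the dominating measure -/

section ChangeOfMeasure

variable {Ω : Type*} [MeasurableSpace Ω]

lemma add_mul_rnDeriv_withDensity_add {κ : Measure Ω} [SigmaFinite κ] {p p₀ r : Ω → ℝ≥0∞}
    (hp : Measurable p) (hp₀ : Measurable p₀) (hr : Measurable r) (hle : r ≤ p + p₀)
    (hi : ∫⁻ x, p x ∂κ ≠ ⊤) (hi₀ : ∫⁻ x, p₀ x ∂κ ≠ ⊤) :
    ∀ᵐ x ∂κ, (p x + p₀ x) *
      (κ.withDensity r).rnDeriv (κ.withDensity p + κ.withDensity p₀) x = r x := by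
  have := isFiniteMeasure_withDensity hi
  have := isFiniteMeasure_withDensity hi₀
  have hri : ∫⁻ x, r x ∂κ ≠ ⊤ := by
    refine ((lintegral_mono hle).trans_lt ?_).ne
    simp only [Pi.add_apply]
    rw [lintegral_add_left hp]
    exact ENNReal.add_lt_top.2 ⟨hi.lt_top, hi₀.lt_top⟩
  have := isFiniteMeasure_withDensity hri
  set S := κ.withDensity p + κ.withDensity p₀ with hS
  have hS' : S = κ.withDensity (p + p₀) := (withDensity_add_left hp p₀).symm
  have hac : κ.withDensity r ≪ S := by
    rw [hS']
    exact Measure.absolutelyContinuous_of_le (withDensity_mono (Eventually.of_forall hle))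
  have h1 := Measure.withDensity_rnDeriv_eq _ _ hac
  have hk : Measurable ((κ.withDensity r).rnDeriv S) := Measure.measurable_rnDeriv _ _
  generalize (κ.withDensity r).rnDeriv S = k at h1 hk ⊢
  rw [hS', ← withDensity_mul _ (hp.add hp₀) hk] at h1
  exact (withDensity_eq_iff_of_sigmaFinite ((hp.add hp₀).mul hk).aemeasurable hr.aemeasurable).1 h1

/-- The defining integral of a score does not depend on the dominating measure. -/
lemma scoreError_withDensity {κ : Measure Ω} [SigmaFinite κ] {p p₀ : Ω → ℝ≥0∞}
    (hp : Measurable p) (hp₀ : Measurable p₀) (hi : ∫⁻ x, p x ∂κ ≠ ⊤)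
    (hi₀ : ∫⁻ x, p₀ x ∂κ ≠ ⊤) (t : ℝ) (b : Ω → ℝ) :
    scoreError t (κ.withDensity p) (κ.withDensity p₀) b =
      ∫⁻ x, ENNReal.ofReal (((√(p x).toReal - √(p₀ x).toReal) / t
        - 1 / 2 * (b x * √(p₀ x).toReal)) ^ 2) ∂κ := by
  have h1 := add_mul_rnDeriv_withDensity_add hp hp₀ hp le_self_add hi hi₀
  have h2 := add_mul_rnDeriv_withDensity_add hp hp₀ hp₀ le_add_self hi hi₀
  have hf : ∀ᵐ x ∂κ, p x + p₀ x < ⊤ := by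
    filter_upwards [ae_lt_top hp hi, ae_lt_top hp₀ hi₀] with x hx hx₀
    exact ENNReal.add_lt_top.2 ⟨hx, hx₀⟩
  unfold scoreError sqrtDensity
  generalize (κ.withDensity p).rnDeriv (κ.withDensity p + κ.withDensity p₀) = k at h1 ⊢
  generalize (κ.withDensity p₀).rnDeriv (κ.withDensity p + κ.withDensity p₀) = k₀ at h2 ⊢
  rw [← withDensity_add_left hp p₀,
    lintegral_withDensity_eq_lintegral_mul_non_measurable _ (hp.add hp₀) hf]
  refine lintegral_congr_ae ?_
  filter_upwards [h1, h2, hf] with x hx hx₀ hfx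
  have e : (p x).toReal = (p x + p₀ x).toReal * (k x).toReal := by
    rw [← ENNReal.toReal_mul, hx]
  have e₀ : (p₀ x).toReal = (p x + p₀ x).toReal * (k₀ x).toReal := by
    rw [← ENNReal.toReal_mul, hx₀]
  rw [Pi.mul_apply, Pi.add_apply, e, e₀, ← ENNReal.ofReal_toReal hfx.ne,
    ENNReal.toReal_ofReal ENNReal.toReal_nonneg, ← ENNReal.ofReal_mul ENNReal.toReal_nonneg,
    Real.sqrt_mul ENNReal.toReal_nonneg, Real.sqrt_mul ENNReal.toReal_nonneg]
  congr 1
  nth_rewrite 1 [← Real.sq_sqrt (ENNReal.toReal_nonneg (a := p x + p₀ x))]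
  ring

lemma hasScore_congr {Q : ℝ → Measure Ω} [IsFiniteMeasure (Q 0)] {b b' : Ω → ℝ}
    (h : b =ᵐ[Q 0] b') (hfin : ∀ᶠ t in 𝓝[>] 0, IsFiniteMeasure (Q t)) (hb : HasScore Q b) :
    HasScore Q b' := by
  rw [hasScore_iff] at hb ⊢
  refine hb.congr' ?_
  filter_upwards [hfin] with t ht
  refine lintegral_congr_ae ?_
  have h2 : ∀ᵐ x ∂(Q t + Q 0), (Q 0).rnDeriv (Q t + Q 0) x ≠ 0 → b x = b' x := by
    rw [← ae_withDensity_iff (Measure.measurable_rnDeriv _ _),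
      Measure.withDensity_rnDeriv_eq _ _ (absolutelyContinuous_add_right _ _)]
    exact h
  filter_upwards [h2] with x hx
  by_cases h0 : (Q 0).rnDeriv (Q t + Q 0) x = 0
  · simp [sqrtDensity, h0]
  · rw [hx h0]

lemma lintegral_mul_ofReal_sqrtDensity_sq {Q ν : Measure Ω} [IsFiniteMeasure Q] [IsFiniteMeasure ν]
    (h : Q ≪ ν) {F : Ω → ℝ≥0∞} (hF : Measurable F) :
    ∫⁻ x, F x * ENNReal.ofReal (sqrtDensity Q ν x ^ 2) ∂ν = ∫⁻ x, F x ∂Q := by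
  rw [← lintegral_rnDeriv_mul h hF.aemeasurable]
  refine lintegral_congr_ae ?_
  filter_upwards [Measure.rnDeriv_lt_top Q ν] with x hx
  rw [sqrtDensity_sq, ENNReal.ofReal_toReal hx.ne, mul_comm]

end ChangeOfMeasure

/-! ### Scores of the observation -/

namespace MixtureModel

variable {A Z : Type*} [MeasurableSpace A] [MeasurableSpace Z]

instance (M : MixtureModel A Z) : SigmaFinite M.μ := M.sigmaFinite

/-- The mixture density `z ↦ ∫ f α z dη(α)` of the observation. -/
noncomputable def mixDensity (M : MixtureModel A Z) (η : Measure A) (z : Z) : ℝ≥0∞ :=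
  ∫⁻ α, (M.f α z : ℝ≥0∞) ∂η

/-- The score of the observation induced by the score `b` of heterogeneity: the conditional
expectation of `b α` given `Z = z`. The value is `0` where the mixture density is `0` or `∞`. -/
noncomputable def inducedScore (M : MixtureModel A Z) (η : Measure A) (b : A → ℝ) (z : Z) : ℝ :=
  (∫ α, (M.f α z : ℝ) * b α ∂η) / (M.mixDensity η z).toReal

variable (M : MixtureModel A Z)

lemma law_eq (η : ProbabilityMeasure A) :
    M.law η = M.μ.withDensity (M.mixDensity (η : Measure A)) := rfl

lemma measurable_f_left (z : Z) : Measurable fun α => M.f α z :=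
  M.measurable_f.comp measurable_prodMk_right

lemma measurable_f_right (α : A) : Measurable (M.f α) :=
  M.measurable_f.comp measurable_prodMk_left

lemma measurable_lintegral_f_mul (η : Measure A) [SFinite η] {F : A → ℝ≥0∞} (hF : Measurable F) :
    Measurable fun z => ∫⁻ α, (M.f α z : ℝ≥0∞) * F α ∂η := by
  have : Measurable fun x : A × Z => (M.f x.1 x.2 : ℝ≥0∞) * F x.1 :=
    M.measurable_f.coe_nnreal_ennreal.mul (hF.comp measurable_fst)
  exact this.lintegral_prod_left'

lemma measurable_mixDensity (η : Measure A) [SFinite η] : Measurable (M.mixDensity η) := by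
  have h := M.measurable_lintegral_f_mul η (F := fun _ => 1) measurable_const
  simp only [mul_one] at h
  exact h

lemma lintegral_lintegral_f_mul {η : Measure A} [SFinite η] (hη : ∀ᵐ α ∂η, α ∈ M.supp)
    {F : A → ℝ≥0∞} (hF : Measurable F) :
    ∫⁻ z, ∫⁻ α, (M.f α z : ℝ≥0∞) * F α ∂η ∂M.μ = ∫⁻ α, F α ∂η := by
  have hm : Measurable fun x : Z × A => (M.f x.2 x.1 : ℝ≥0∞) * F x.2 :=
    (M.measurable_f.comp measurable_swap).coe_nnreal_ennreal.mul (hF.comp measurable_snd)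
  rw [lintegral_lintegral_swap hm.aemeasurable]
  refine lintegral_congr_ae ?_
  filter_upwards [hη] with α hα
  rw [lintegral_mul_const _ (M.measurable_f_right α).coe_nnreal_ennreal, M.lintegral_f α hα,
    one_mul]

lemma lintegral_mixDensity {η : Measure A} [IsProbabilityMeasure η]
    (hη : ∀ᵐ α ∂η, α ∈ M.supp) : ∫⁻ z, M.mixDensity η z ∂M.μ = 1 := by
  simpa [mixDensity] using M.lintegral_lintegral_f_mul hη (F := fun _ => 1) measurable_const

lemma isProbabilityMeasure_law {η : ProbabilityMeasure A} (hη : η ∈ M.H) :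
    IsProbabilityMeasure (M.law η) :=
  ⟨by rw [law_eq, withDensity_apply _ MeasurableSet.univ, Measure.restrict_univ,
    M.lintegral_mixDensity (M.carried η hη)]⟩

lemma measurable_inducedScore (η : Measure A) [SFinite η] {b : A → ℝ} (hb : Measurable b) :
    Measurable (M.inducedScore η b) := by
  have : Measurable fun x : A × Z => (M.f x.1 x.2 : ℝ) * b x.1 :=
    M.measurable_f.coe_nnreal_real.mul (hb.comp measurable_fst)
  have h := (this.stronglyMeasurable.integral_prod_left' (μ := η)).measurable
  exact h.div (M.measurable_mixDensity η).ennreal_toReal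

/-- The measure `ν` weighted by the likelihood of `α` at the observation `z`: the unnormalized
posterior distribution when `ν` is the prior. -/
noncomputable def likelihoodMeasure (ν : Measure A) (z : Z) : Measure A :=
  ν.withDensity fun α => (M.f α z : ℝ≥0∞)

lemma lintegral_likelihoodMeasure (ν : Measure A) (z : Z) (F : A → ℝ≥0∞) :
    ∫⁻ α, F α ∂(M.likelihoodMeasure ν z) = ∫⁻ α, (M.f α z : ℝ≥0∞) * F α ∂ν :=
  lintegral_withDensity_eq_lintegral_mul_non_measurable _
    (M.measurable_f_left z).coe_nnreal_ennreal (by simp) F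

lemma integral_likelihoodMeasure (ν : Measure A) (z : Z) (F : A → ℝ) :
    ∫ α, F α ∂(M.likelihoodMeasure ν z) = ∫ α, (M.f α z : ℝ) * F α ∂ν := by
  rw [likelihoodMeasure, integral_withDensity_eq_integral_toReal_smul
    (M.measurable_f_left z).coe_nnreal_ennreal (by simp)]
  simp

/-- The score of the observation is pointwise controlled: `E[b | Z]² ≤ E[b² | Z]`. -/
lemma mixDensity_mul_sq_inducedScore_le (η : Measure A) {b : A → ℝ} (hb : Measurable b)
    {z : Z} (hz : M.mixDensity η z < ⊤) :
    M.mixDensity η z * ENNReal.ofReal (M.inducedScore η b z ^ 2) ≤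
      ∫⁻ α, (M.f α z : ℝ≥0∞) * ENNReal.ofReal (b α ^ 2) ∂η := by
  by_cases hB : ∫⁻ α, (M.f α z : ℝ≥0∞) * ENNReal.ofReal (b α ^ 2) ∂η = ⊤
  · rw [hB]; exact le_top
  have h1 : MemLp (fun _ : A => (1 : ℝ)) 2 (M.likelihoodMeasure η z) := by
    refine memLp_two_of_lintegral_lt_top aestronglyMeasurable_const ?_
    rw [lintegral_likelihoodMeasure]
    simpa [mixDensity] using hz
  have h2 : MemLp b 2 (M.likelihoodMeasure η z) := by
    refine memLp_two_of_lintegral_lt_top hb.aestronglyMeasurable ?_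
    rw [lintegral_likelihoodMeasure]
    exact lt_top_iff_ne_top.2 hB
  have e1 : M.mixDensity η z = ENNReal.ofReal (‖h1.toLp _‖ ^ 2) := by
    rw [ofReal_norm_toLp_sq h1, lintegral_likelihoodMeasure]
    simp [mixDensity]
  have e2 := ofReal_norm_toLp_sq h2
  rw [lintegral_likelihoodMeasure] at e2
  have e3 := inner_toLp_toLp h2 h1
  simp only [mul_one] at e3
  rw [integral_likelihoodMeasure] at e3
  rw [inducedScore, ← e2, e1, ← e3, ← ENNReal.ofReal_mul (sq_nonneg _),
    ENNReal.toReal_ofReal (sq_nonneg _)]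
  refine ENNReal.ofReal_le_ofReal ?_
  have hcs := abs_real_inner_le_norm (h2.toLp b) (h1.toLp _)
  have hcs2 := pow_le_pow_left₀ (abs_nonneg _) hcs 2
  rw [sq_abs, mul_pow] at hcs2
  by_cases h0 : ‖h1.toLp _‖ = 0
  · rw [h0]; simp
  rw [div_pow]
  have hp : 0 < ‖h1.toLp _‖ ^ 2 := by positivity
  rw [← mul_div_assoc, div_le_iff₀ (by positivity)]
  nlinarith

lemma memLp_inducedScore {η : ProbabilityMeasure A} (hη : η ∈ M.H) {b : A → ℝ}
    (hbm : Measurable b) (hb : MemLp b 2 (η : Measure A)) :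
    MemLp (M.inducedScore (η : Measure A) b) 2 (M.law η) := by
  have hfin : ∀ᵐ z ∂M.μ, M.mixDensity (η : Measure A) z < ⊤ :=
    ae_lt_top (M.measurable_mixDensity _) (by simp [M.lintegral_mixDensity (M.carried η hη)])
  refine memLp_two_of_lintegral_lt_top
    (M.measurable_inducedScore _ hbm).aestronglyMeasurable ?_
  rw [law_eq, lintegral_withDensity_eq_lintegral_mul_non_measurable _
    (M.measurable_mixDensity _) hfin]
  refine (lintegral_mono_ae (hfin.mono fun z hz =>
    M.mixDensity_mul_sq_inducedScore_le (η : Measure A) hbm hz)).trans_lt ?_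
  rw [M.lintegral_lintegral_f_mul (M.carried η hη) (by fun_prop), ← ofReal_norm_toLp_sq hb]
  exact ENNReal.ofReal_lt_top

/-- The part of `z ↦ E[b² | Z = z]`, times the density of `Z`, where this conditional moment
exceeds the level `K`. -/
noncomputable def truncatedMoment (η : Measure A) (b : A → ℝ) (K : ℕ) (z : Z) : ℝ≥0∞ :=
  if K * M.mixDensity η z < ∫⁻ α, (M.f α z : ℝ≥0∞) * ENNReal.ofReal (b α ^ 2) ∂η then
    ∫⁻ α, (M.f α z : ℝ≥0∞) * ENNReal.ofReal (b α ^ 2) ∂η else 0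

lemma measurable_truncatedMoment (η : Measure A) [SFinite η] {b : A → ℝ} (hb : Measurable b)
    (K : ℕ) : Measurable (M.truncatedMoment η b K) := by
  have h := M.measurable_lintegral_f_mul η (F := fun α => ENNReal.ofReal (b α ^ 2)) (by fun_prop)
  exact Measurable.ite (measurableSet_lt ((M.measurable_mixDensity η).const_mul _) h) h
    measurable_const

lemma tendsto_lintegral_truncatedMoment {η : ProbabilityMeasure A} (hη : η ∈ M.H) {b : A → ℝ}
    (hbm : Measurable b) (hb : MemLp b 2 (η : Measure A)) :
    Tendsto (fun K : ℕ => ∫⁻ z, M.truncatedMoment (η : Measure A) b K z ∂M.μ) atTop (𝓝 0) := by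
  have hmF : Measurable fun α => ENNReal.ofReal (b α ^ 2) := by fun_prop
  have hm := M.measurable_lintegral_f_mul (η : Measure A) hmF
  have hfinB : ∫⁻ z, ∫⁻ α, (M.f α z : ℝ≥0∞) * ENNReal.ofReal (b α ^ 2) ∂(η : Measure A) ∂M.μ
      ≠ ⊤ := by
    rw [M.lintegral_lintegral_f_mul (M.carried η hη) hmF, ← ofReal_norm_toLp_sq hb]
    exact ENNReal.ofReal_ne_top
  rw [← lintegral_zero (μ := M.μ)]
  refine tendsto_lintegral_of_dominated_convergence
    (fun z => ∫⁻ α, (M.f α z : ℝ≥0∞) * ENNReal.ofReal (b α ^ 2) ∂(η : Measure A))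
    (fun K => M.measurable_truncatedMoment _ hbm K) (fun K => Eventually.of_forall fun z => ?_)
    hfinB ?_
  · unfold truncatedMoment
    split_ifs
    · exact le_rfl
    · exact zero_le
  · filter_upwards [ae_lt_top hm hfinB] with z hz
    refine tendsto_const_nhds.congr' ?_
    by_cases h0 : M.mixDensity (η : Measure A) z = 0
    · -- where the mixture density vanishes, so does the moment of `b`
      have h1 : ∀ᵐ α ∂(η : Measure A), (M.f α z : ℝ≥0∞) = 0 :=
        (lintegral_eq_zero_iff (M.measurable_f_left z).coe_nnreal_ennreal).1 h0
      have h2 : ∫⁻ α, (M.f α z : ℝ≥0∞) * ENNReal.ofReal (b α ^ 2) ∂(η : Measure A) = 0 := by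
        rw [← lintegral_zero (μ := (η : Measure A))]
        exact lintegral_congr_ae (h1.mono fun α hα => by simp [hα])
      exact Eventually.of_forall fun K => by simp [truncatedMoment, h2]
    · obtain ⟨n, hn⟩ := ENNReal.exists_nat_mul_gt h0 hz.ne
      filter_upwards [eventually_ge_atTop n] with K hK
      rw [truncatedMoment, if_neg]
      refine not_lt.2 (hn.le.trans ?_)
      gcongr

/-- The pointwise comparison, at an observation `z`, of the mixture densities of two
distributions: norm differentiation in `L²` of the likelihood measure at `z`. -/
lemma ofReal_sq_sqrt_mixDensity_le {η η₀ : Measure A} [IsFiniteMeasure η] [IsFiniteMeasure η₀]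
    {b : A → ℝ} (hbm : Measurable b) {t : ℝ} (ht : 0 < t) (K : ℕ) {z : Z}
    (hz : M.mixDensity η z < ⊤) (hz₀ : M.mixDensity η₀ z < ⊤)
    (hB : ∫⁻ α, (M.f α z : ℝ≥0∞) * ENNReal.ofReal (b α ^ 2) ∂η₀ < ⊤) :
    ENNReal.ofReal (((√(M.mixDensity η z).toReal - √(M.mixDensity η₀ z).toReal) / t
        - 1 / 2 * (M.inducedScore η₀ b z * √(M.mixDensity η₀ z).toReal)) ^ 2) ≤
      2 * (∫⁻ α, (M.f α z : ℝ≥0∞) * ENNReal.ofReal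
        (((sqrtDensity η (η + η₀) α - sqrtDensity η₀ (η + η₀) α) / t
          - 1 / 2 * (b α * sqrtDensity η₀ (η + η₀) α)) ^ 2) ∂(η + η₀)) +
      2 * (K * (∫⁻ α, (M.f α z : ℝ≥0∞) * ENNReal.ofReal
        ((sqrtDensity η (η + η₀) α - sqrtDensity η₀ (η + η₀) α) ^ 2) ∂(η + η₀)) +
        M.truncatedMoment η₀ b K z) := by
  have hac := absolutelyContinuous_add_left η η₀
  have hac₀ := absolutelyContinuous_add_right η η₀
  have hum := measurable_sqrtDensity η (η + η₀)
  have hvm := measurable_sqrtDensity η₀ (η + η₀)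
  have hfm := (M.measurable_f_left z).coe_nnreal_ennreal
  have eu := lintegral_mul_ofReal_sqrtDensity_sq hac hfm
  have ev := lintegral_mul_ofReal_sqrtDensity_sq hac₀ hfm
  have ew := lintegral_mul_ofReal_sqrtDensity_sq hac₀
    (F := fun α => (M.f α z : ℝ≥0∞) * ENNReal.ofReal (b α ^ 2)) (hfm.mul (by fun_prop))
  have ew' : ∀ α, (M.f α z : ℝ≥0∞) * ENNReal.ofReal ((b α * sqrtDensity η₀ (η + η₀) α) ^ 2) =
      (M.f α z : ℝ≥0∞) * ENNReal.ofReal (b α ^ 2)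
        * ENNReal.ofReal (sqrtDensity η₀ (η + η₀) α ^ 2) := fun α => by
    rw [mul_pow, ENNReal.ofReal_mul (sq_nonneg _), mul_assoc]
  simp only [← ew'] at ew
  rw [← M.lintegral_likelihoodMeasure (η + η₀)] at eu ev ew
  have hu : MemLp (sqrtDensity η (η + η₀)) 2 (M.likelihoodMeasure (η + η₀) z) :=
    memLp_two_of_lintegral_lt_top hum.aestronglyMeasurable (eu.trans_lt hz)
  have hv : MemLp (sqrtDensity η₀ (η + η₀)) 2 (M.likelihoodMeasure (η + η₀) z) :=
    memLp_two_of_lintegral_lt_top hvm.aestronglyMeasurable (ev.trans_lt hz₀)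
  have hw : MemLp (fun α => b α * sqrtDensity η₀ (η + η₀) α) 2
      (M.likelihoodMeasure (η + η₀) z) :=
    memLp_two_of_lintegral_lt_top (hbm.mul hvm).aestronglyMeasurable (ew.trans_lt hB)
  have hD : MemLp (fun α => sqrtDensity η (η + η₀) α - sqrtDensity η₀ (η + η₀) α) 2
      (M.likelihoodMeasure (η + η₀) z) := hu.sub hv
  have hR : MemLp (fun α => (sqrtDensity η (η + η₀) α - sqrtDensity η₀ (η + η₀) α) / t
      - 1 / 2 * (b α * sqrtDensity η₀ (η + η₀) α)) 2 (M.likelihoodMeasure (η + η₀) z) := by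
    refine ((hD.const_mul t⁻¹).sub (hw.const_mul (1 / 2))).ae_eq
      (Eventually.of_forall fun x => ?_)
    simp [div_eq_inv_mul]
  have hDn : hD.toLp _ = hu.toLp _ - hv.toLp _ := MemLp.toLp_sub hu hv
  have hRn : hR.toLp _ = t⁻¹ • (hu.toLp _ - hv.toLp _) - (1 / 2 : ℝ) • hw.toLp _ := by
    rw [← hDn, ← MemLp.toLp_const_smul, ← MemLp.toLp_const_smul, ← MemLp.toLp_sub]
    congr 1; ext x
    simp [div_eq_inv_mul]
  have hvw : hv.toLp _ = 0 → hw.toLp _ = 0 := fun h => by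
    rw [Lp.eq_zero_iff_ae_eq_zero] at h ⊢
    filter_upwards [h, hv.coeFn_toLp, hw.coeFn_toLp] with α h1 h2 h3
    rw [h3, ← h2, h1]
    simp
  rw [← ofReal_norm_toLp_sq hu] at eu
  rw [← ofReal_norm_toLp_sq hv] at ev
  rw [← ofReal_norm_toLp_sq hw] at ew
  have eip : inner ℝ (hw.toLp _) (hv.toLp _) = ∫ α, (M.f α z : ℝ) * b α ∂η₀ := by
    rw [inner_toLp_toLp, M.integral_likelihoodMeasure]
    have := integral_mul_sqrtDensity_sq hac₀ (fun α => (M.f α z : ℝ) * b α) MeasurableSet.univ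
    simp only [Measure.restrict_univ] at this
    rw [← this]
    exact integral_congr_ae (Eventually.of_forall fun α => by ring)
  have epu : √(M.mixDensity η z).toReal = ‖hu.toLp _‖ := by
    rw [mixDensity, ← eu, ENNReal.toReal_ofReal (sq_nonneg _), Real.sqrt_sq (norm_nonneg _)]
  have epv : √(M.mixDensity η₀ z).toReal = ‖hv.toLp _‖ := by
    rw [mixDensity, ← ev, ENNReal.toReal_ofReal (sq_nonneg _), Real.sqrt_sq (norm_nonneg _)]
  have eg : M.inducedScore η₀ b z * ‖hv.toLp _‖ =
      inner ℝ (hw.toLp _) (hv.toLp _) / ‖hv.toLp _‖ := by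
    rw [inducedScore, ← eip, mixDensity, ← ev, ENNReal.toReal_ofReal (sq_nonneg _)]
    by_cases h0 : ‖hv.toLp _‖ = 0
    · rw [h0]; simp
    · field_simp
  rw [epu, epv, eg, ← M.lintegral_likelihoodMeasure, ← M.lintegral_likelihoodMeasure,
    ← ofReal_norm_toLp_sq hR, ← ofReal_norm_toLp_sq hD, hRn, hDn]
  refine (ENNReal.ofReal_le_ofReal (sq_norm_sub_norm_div_le (hu.toLp _) (hv.toLp _) (hw.toLp _) ht
    hvw K.cast_nonneg)).trans_eq ?_
  have hite : ENNReal.ofReal (if (K : ℝ) * ‖hv.toLp _‖ ^ 2 < ‖hw.toLp _‖ ^ 2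
      then ‖hw.toLp _‖ ^ 2 else 0) = M.truncatedMoment η₀ b K z := by
    rw [truncatedMoment, ← ew, mixDensity, ← ev, ← ENNReal.ofReal_natCast,
      ← ENNReal.ofReal_mul K.cast_nonneg]
    simp only [ENNReal.ofReal_lt_ofReal_iff_of_nonneg
      (mul_nonneg K.cast_nonneg (sq_nonneg ‖hv.toLp _‖))]
    split_ifs <;> simp
  rw [← hite, ENNReal.ofReal_add (by positivity) (by split_ifs <;> positivity),
    ENNReal.ofReal_mul zero_le_two, ENNReal.ofReal_mul zero_le_two,
    ENNReal.ofReal_add (by positivity) (by split_ifs <;> positivity),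
    ENNReal.ofReal_mul K.cast_nonneg]
  simp

/-- Mixing contracts the score remainder, up to a term of order `t²` and a truncation error that
does not depend on the path. -/
lemma scoreError_law_le {η η₀ : ProbabilityMeasure A} (hη : η ∈ M.H) (hη₀ : η₀ ∈ M.H)
    {b : A → ℝ} (hbm : Measurable b) (hb : MemLp b 2 (η₀ : Measure A)) {t : ℝ} (ht : 0 < t)
    (K : ℕ) :
    scoreError t (M.law η) (M.law η₀) (M.inducedScore (η₀ : Measure A) b) ≤
      2 * scoreError t η η₀ b + 2 * (K * (ENNReal.ofReal (t ^ 2) * (2 * scoreError t η η₀ b +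
        ∫⁻ α, ENNReal.ofReal (b α ^ 2) ∂(η₀ : Measure A))) +
        ∫⁻ z, M.truncatedMoment (η₀ : Measure A) b K z ∂M.μ) := by
  have hm := M.measurable_mixDensity (η : Measure A)
  have hm₀ := M.measurable_mixDensity (η₀ : Measure A)
  have hi : ∫⁻ z, M.mixDensity (η : Measure A) z ∂M.μ ≠ ⊤ := by
    simp [M.lintegral_mixDensity (M.carried η hη)]
  have hi₀ : ∫⁻ z, M.mixDensity (η₀ : Measure A) z ∂M.μ ≠ ⊤ := by
    simp [M.lintegral_mixDensity (M.carried η₀ hη₀)]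
  have hmF : Measurable fun α => ENNReal.ofReal (b α ^ 2) := by fun_prop
  have hiB : ∫⁻ z, ∫⁻ α, (M.f α z : ℝ≥0∞) * ENNReal.ofReal (b α ^ 2) ∂(η₀ : Measure A) ∂M.μ
      ≠ ⊤ := by
    rw [M.lintegral_lintegral_f_mul (M.carried η₀ hη₀) hmF, ← ofReal_norm_toLp_sq hb]
    exact ENNReal.ofReal_ne_top
  have hsupp : ∀ᵐ α ∂((η : Measure A) + η₀), α ∈ M.supp := by
    rw [ae_add_measure_iff]
    exact ⟨M.carried η hη, M.carried η₀ hη₀⟩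
  have hac₀ := absolutelyContinuous_add_right (η : Measure A) η₀
  have hum := measurable_sqrtDensity (η : Measure A) ((η : Measure A) + η₀)
  have hvm := measurable_sqrtDensity (η₀ : Measure A) ((η : Measure A) + η₀)
  set u := sqrtDensity (η : Measure A) ((η : Measure A) + η₀)
  set v := sqrtDensity (η₀ : Measure A) ((η : Measure A) + η₀)
  have hRm : Measurable fun α => ENNReal.ofReal (((u α - v α) / t - 1 / 2 * (b α * v α)) ^ 2) := by
    fun_prop
  have hDm : Measurable fun α => ENNReal.ofReal ((u α - v α) ^ 2) := by fun_prop
  -- the score expansion makes `u - v` of order `t` in mean square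
  have hD : ∫⁻ α, ENNReal.ofReal ((u α - v α) ^ 2) ∂((η : Measure A) + (η₀ : Measure A)) ≤
      ENNReal.ofReal (t ^ 2) * (2 * scoreError t (η : Measure A) η₀ b +
        ∫⁻ α, ENNReal.ofReal (b α ^ 2) ∂(η₀ : Measure A)) := by
    rw [← lintegral_mul_ofReal_sqrtDensity_sq hac₀ hmF, scoreError,
      ← lintegral_const_mul _ hRm, ← lintegral_add_left (hRm.const_mul _), ← lintegral_const_mul]
    · refine lintegral_mono fun α => ?_
      rw [← ENNReal.ofReal_mul (sq_nonneg _), ← ENNReal.ofReal_ofNat 2,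
        ← ENNReal.ofReal_mul zero_le_two, ← ENNReal.ofReal_add (by positivity) (by positivity),
        ← ENNReal.ofReal_mul (sq_nonneg _)]
      refine ENNReal.ofReal_le_ofReal ?_
      have : u α - v α = t * (((u α - v α) / t - 1 / 2 * (b α * v α)) + 1 / 2 * (b α * v α)) := by
        field_simp
        ring
      calc (u α - v α) ^ 2 = t ^ 2 *
            (((u α - v α) / t - 1 / 2 * (b α * v α)) + 1 / 2 * (b α * v α)) ^ 2 := by
            rw [← mul_pow, ← this]
        _ ≤ _ := by
          gcongr
          refine add_sq_le.trans ?_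
          have := mul_nonneg (sq_nonneg (b α)) (sq_nonneg (v α))
          linarith [mul_pow (b α) (v α) 2, mul_pow (1 / 2) (b α * v α) 2]
    · exact (hRm.const_mul _).add (hmF.mul (hvm.pow_const 2).ennreal_ofReal)
  rw [law_eq, law_eq, scoreError_withDensity hm hm₀ hi hi₀]
  calc _ ≤ ∫⁻ z, (2 * (∫⁻ α, (M.f α z : ℝ≥0∞) * ENNReal.ofReal
        (((u α - v α) / t - 1 / 2 * (b α * v α)) ^ 2) ∂((η : Measure A) + (η₀ : Measure A))) +
      2 * (K * (∫⁻ α, (M.f α z : ℝ≥0∞) * ENNReal.ofReal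
        ((u α - v α) ^ 2) ∂((η : Measure A) + (η₀ : Measure A))) +
        M.truncatedMoment (η₀ : Measure A) b K z)) ∂M.μ := by
        refine lintegral_mono_ae ?_
        filter_upwards [ae_lt_top hm hi, ae_lt_top hm₀ hi₀,
          ae_lt_top (M.measurable_lintegral_f_mul _ hmF) hiB] with z h1 h2 h3
        exact M.ofReal_sq_sqrt_mixDensity_le hbm ht K h1 h2 h3
    _ = 2 * scoreError t (η : Measure A) η₀ b +
      2 * (K * (∫⁻ α, ENNReal.ofReal ((u α - v α) ^ 2) ∂((η : Measure A) + (η₀ : Measure A))) +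
        ∫⁻ z, M.truncatedMoment (η₀ : Measure A) b K z ∂M.μ) := by
        have m1 := M.measurable_lintegral_f_mul ((η : Measure A) + (η₀ : Measure A)) hRm
        have m2 := M.measurable_lintegral_f_mul ((η : Measure A) + (η₀ : Measure A)) hDm
        have m3 : Measurable fun z => (K : ℝ≥0∞) * (∫⁻ α, (M.f α z : ℝ≥0∞) *
            ENNReal.ofReal ((u α - v α) ^ 2) ∂((η : Measure A) + (η₀ : Measure A))) +
            M.truncatedMoment (η₀ : Measure A) b K z :=
          (m2.const_mul _).add (M.measurable_truncatedMoment _ hbm K)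
        rw [lintegral_add_left (m1.const_mul _), lintegral_const_mul _ m1,
          lintegral_const_mul _ m3, lintegral_add_left (m2.const_mul _),
          lintegral_const_mul _ m2, M.lintegral_lintegral_f_mul hsupp hRm,
          M.lintegral_lintegral_f_mul hsupp hDm]
        rfl
    _ ≤ _ := by gcongr

/-- Mean-square differentiability is inherited by mixtures: a path of heterogeneity distributions
with score `b` induces a path of laws of `Z` with score `E[b | Z]`. -/
lemma IsSubmodel.hasScore_law {M : MixtureModel A Z} {η₀ : ProbabilityMeasure A} (hη₀ : η₀ ∈ M.H)
    {γ : ℝ → ProbabilityMeasure A} {b : Lp ℝ 2 (η₀ : Measure A)} (h : M.IsSubmodel η₀ γ b) :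
    HasScore (fun t => M.law (γ t)) (M.inducedScore (η₀ : Measure A) b) := by
  obtain ⟨⟨h0, ε, hε, hγ⟩, hs⟩ := h
  have hbm : Measurable b := (Lp.stronglyMeasurable b).measurable
  have hb : MemLp b 2 (η₀ : Measure A) := Lp.memLp b
  rw [hasScore_iff] at hs ⊢
  simp only [h0] at hs ⊢
  have hβ : ∫⁻ α, ENNReal.ofReal (b α ^ 2) ∂(η₀ : Measure A) ≠ ⊤ := by
    rw [← ofReal_norm_toLp_sq hb]
    exact ENNReal.ofReal_ne_top
  rw [ENNReal.tendsto_nhds_zero]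
  intro e he
  have he2 : 0 < e / 2 / 2 := ENNReal.div_pos (ENNReal.div_pos he.ne' (by simp)).ne' (by simp)
  -- the truncation level is fixed first, independently of `t`
  obtain ⟨K, hK⟩ := ((M.tendsto_lintegral_truncatedMoment hη₀ hbm hb).eventually
    (gt_mem_nhds he2)).exists
  have ht2 : Tendsto (fun t : ℝ => ENNReal.ofReal (t ^ 2)) (𝓝[>] 0) (𝓝 0) := by
    have : Tendsto (fun t : ℝ => ENNReal.ofReal (t ^ 2)) (𝓝 0) (𝓝 (ENNReal.ofReal (0 ^ 2))) :=
      ENNReal.tendsto_ofReal ((continuous_pow 2).tendsto 0)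
    simpa using this.mono_left nhdsWithin_le_nhds
  have hlim : Tendsto (fun t : ℝ => 2 * scoreError t (γ t) η₀ b + 2 * (K * (ENNReal.ofReal (t ^ 2) *
      (2 * scoreError t (γ t) η₀ b + ∫⁻ α, ENNReal.ofReal (b α ^ 2) ∂(η₀ : Measure A)))))
      (𝓝[>] 0) (𝓝 0) := by
    have l1 := ENNReal.Tendsto.const_mul (a := 2) hs (Or.inr (by simp))
    have l2 := l1.add_const (∫⁻ α, ENNReal.ofReal (b α ^ 2) ∂(η₀ : Measure A))
    rw [mul_zero, zero_add] at l2
    have l3 := ENNReal.Tendsto.mul ht2 (Or.inr hβ) l2 (Or.inr (by simp))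
    rw [zero_mul] at l3
    have l4 := ENNReal.Tendsto.const_mul (a := 2)
      (ENNReal.Tendsto.const_mul (a := (K : ℝ≥0∞)) l3 (Or.inr (by simp))) (Or.inr (by simp))
    simpa using l1.add l4
  filter_upwards [ENNReal.tendsto_nhds_zero.1 hlim (e / 2) (ENNReal.half_pos he.ne'),
    Ioo_mem_nhdsGT hε] with t ht hte
  refine (M.scoreError_law_le (hγ t ⟨hte.1.le, hte.2⟩) hη₀ hbm hb hte.1 K).trans ?_
  rw [mul_add, ← add_assoc]
  calc _ ≤ e / 2 + 2 * (e / 2 / 2) := by gcongr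
    _ = e := by rw [ENNReal.mul_div_cancel (by simp) (by simp), ENNReal.add_halves]

end MixtureModel

/-! ### Finite efficiency bounds and the adjoint of the score operator -/

/-- A linear relation dominated by the norm of its first component is represented by a vector. -/
lemma exists_inner_eq_of_sq_le {E : Type*} [NormedAddCommGroup E] [InnerProductSpace ℝ E]
    [CompleteSpace E] (W : Submodule ℝ (E × ℝ)) (K : ℝ)
    (h : ∀ p ∈ W, p.2 ^ 2 ≤ K * ‖p.1‖ ^ 2) : ∃ s : E, ∀ p ∈ W, inner ℝ s p.1 = p.2 := by
  have hker : ∀ p ∈ W, p.1 = 0 → p.2 = 0 := fun p hp h0 => by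
    have := h p hp
    rw [h0, norm_zero] at this
    exact pow_eq_zero_iff two_ne_zero |>.1 (le_antisymm (by simpa using this) (sq_nonneg _))
  have hgraph := W.toLinearPMap_graph_eq hker
  set F := W.toLinearPMap
  have hF : ∀ x : F.domain, ‖F.toFun x‖ ≤ √K * ‖x‖ := fun x => by
    have hx : ((x : E), F x) ∈ W := by rw [← hgraph]; exact F.mem_graph x
    have h1 := Real.sqrt_le_sqrt (h _ hx)
    rw [Real.sqrt_mul' _ (sq_nonneg _), Real.sqrt_sq (norm_nonneg _), Real.sqrt_sq_eq_abs] at h1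
    exact h1
  obtain ⟨G, hG, -⟩ := exists_extension_norm_eq F.domain (F.toFun.mkContinuous _ hF)
  refine ⟨(InnerProductSpace.toDual ℝ E).symm G, fun p hp => ?_⟩
  rw [InnerProductSpace.toDual_symm_apply]
  rw [← hgraph, LinearPMap.mem_graph_iff] at hp
  obtain ⟨y, hy1, hy2⟩ := hp
  rw [← hy1, ← hy2, hG]
  rfl

namespace MixtureModel

variable {A Z : Type*} [MeasurableSpace A] [MeasurableSpace Z] {M : MixtureModel A Z}
  {η₀ : ProbabilityMeasure A}

/-- The adjoint of the score operator: `α ↦ E[s(Z) | α]`. -/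
noncomputable def adjointScore (M : MixtureModel A Z) (s : Z → ℝ) (α : A) : ℝ :=
  ∫ z, s z * (M.f α z : ℝ) ∂M.μ

lemma adjointScore_one {α : A} (hα : α ∈ M.supp) : M.adjointScore (fun _ => 1) α = 1 := by
  have h := M.lintegral_f α hα
  have h2 := integral_toReal (μ := M.μ) (f := fun z => (M.f α z : ℝ≥0∞))
    (M.measurable_f_right α).coe_nnreal_ennreal.aemeasurable (by simp)
  rw [h] at h2
  simpa [adjointScore] using h2

lemma mixDensity_lt_top (hη₀ : η₀ ∈ M.H) : ∀ᵐ z ∂M.μ, M.mixDensity (η₀ : Measure A) z < ⊤ :=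
  ae_lt_top (M.measurable_mixDensity _) (by simp [M.lintegral_mixDensity (M.carried η₀ hη₀)])

lemma inducedScore_one (hη₀ : η₀ ∈ M.H) :
    ∀ᵐ z ∂(M.law η₀), M.inducedScore (η₀ : Measure A) (fun _ => 1) z = 1 := by
  rw [law_eq, ae_withDensity_iff (M.measurable_mixDensity _)]
  filter_upwards [mixDensity_lt_top hη₀] with z hz h0
  have h2 := integral_toReal (μ := (η₀ : Measure A)) (f := fun α => (M.f α z : ℝ≥0∞))
    (M.measurable_f_left z).coe_nnreal_ennreal.aemeasurable (by simp)
  simp only [ENNReal.coe_toReal] at h2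
  simp only [inducedScore, mul_one]
  rw [h2]
  exact div_self (ENNReal.toReal_ne_zero.2 ⟨h0, hz.ne⟩)

lemma lintegral_law (hη₀ : η₀ ∈ M.H) (F : Z → ℝ≥0∞) :
    ∫⁻ z, F z ∂(M.law η₀) = ∫⁻ z, M.mixDensity (η₀ : Measure A) z * F z ∂M.μ := by
  rw [law_eq, lintegral_withDensity_eq_lintegral_mul_non_measurable _ (M.measurable_mixDensity _)
    (mixDensity_lt_top hη₀)]
  rfl

lemma lintegral_lintegral_f_mul_right (hη₀ : η₀ ∈ M.H) {F : Z → ℝ≥0∞} (hF : Measurable F) :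
    ∫⁻ α, ∫⁻ z, (M.f α z : ℝ≥0∞) * F z ∂M.μ ∂(η₀ : Measure A) = ∫⁻ z, F z ∂(M.law η₀) := by
  have hm : Measurable fun x : A × Z => (M.f x.1 x.2 : ℝ≥0∞) * F x.2 :=
    M.measurable_f.coe_nnreal_ennreal.mul (hF.comp measurable_snd)
  rw [lintegral_lintegral_swap hm.aemeasurable, lintegral_law hη₀]
  refine lintegral_congr fun z => ?_
  rw [lintegral_mul_const _ (M.measurable_f_left z).coe_nnreal_ennreal, mixDensity]

lemma integrable_mul_mul_f (hη₀ : η₀ ∈ M.H) {b : A → ℝ} (hbm : Measurable b)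
    (hb : MemLp b 2 (η₀ : Measure A)) {s : Z → ℝ} (hsm : Measurable s)
    (hs : MemLp s 2 (M.law η₀)) :
    Integrable (fun x : A × Z => b x.1 * (s x.2 * (M.f x.1 x.2 : ℝ)))
      ((η₀ : Measure A).prod M.μ) := by
  have hf := M.measurable_f
  have hfr : Measurable fun x : A × Z => (M.f x.1 x.2 : ℝ) := hf.coe_nnreal_real
  have hfe : Measurable fun x : A × Z => (M.f x.1 x.2 : ℝ≥0∞) := hf.coe_nnreal_ennreal
  have hb2 : Measurable fun α => ENNReal.ofReal (b α ^ 2) := by fun_prop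
  have hs2 : Measurable fun z => ENNReal.ofReal (s z ^ 2) := by fun_prop
  have hm1 : Measurable fun x : A × Z => (M.f x.1 x.2 : ℝ≥0∞) * ENNReal.ofReal (b x.1 ^ 2) :=
    hfe.mul (hb2.comp measurable_fst)
  have hm2 : Measurable fun x : A × Z => (M.f x.1 x.2 : ℝ≥0∞) * ENNReal.ofReal (s x.2 ^ 2) :=
    hfe.mul (hs2.comp measurable_snd)
  refine ⟨((hbm.comp measurable_fst).mul
    ((hsm.comp measurable_snd).mul hfr)).aestronglyMeasurable, ?_⟩
  rw [hasFiniteIntegral_iff_norm]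
  calc ∫⁻ x, ENNReal.ofReal ‖b x.1 * (s x.2 * (M.f x.1 x.2 : ℝ))‖ ∂((η₀ : Measure A).prod M.μ)
      ≤ ∫⁻ x, ((M.f x.1 x.2 : ℝ≥0∞) * ENNReal.ofReal (b x.1 ^ 2) +
          (M.f x.1 x.2 : ℝ≥0∞) * ENNReal.ofReal (s x.2 ^ 2)) ∂((η₀ : Measure A).prod M.μ) := by
        refine lintegral_mono fun x => ?_
        rw [← mul_add, ← ENNReal.ofReal_add (sq_nonneg _) (sq_nonneg _),
          ← ENNReal.ofReal_coe_nnreal, ← ENNReal.ofReal_mul NNReal.zero_le_coe]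
        refine ENNReal.ofReal_le_ofReal ?_
        rw [norm_mul, norm_mul, Real.norm_of_nonneg (M.f x.1 x.2).coe_nonneg, ← mul_assoc, mul_comm]
        gcongr
        rw [Real.norm_eq_abs, Real.norm_eq_abs]
        nlinarith [sq_nonneg (|b x.1| - |s x.2|), sq_abs (b x.1), sq_abs (s x.2),
          sq_nonneg (b x.1), sq_nonneg (s x.2)]
    _ = ∫⁻ α, ENNReal.ofReal (b α ^ 2) ∂(η₀ : Measure A) +
          ∫⁻ z, ENNReal.ofReal (s z ^ 2) ∂(M.law η₀) := by
        rw [lintegral_add_left hm1, lintegral_prod _ hm1.aemeasurable,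
          lintegral_prod _ hm2.aemeasurable, lintegral_lintegral_f_mul_right hη₀ hs2]
        congr 1
        rw [lintegral_lintegral_swap hm1.aemeasurable,
          M.lintegral_lintegral_f_mul (M.carried η₀ hη₀) hb2]
    _ < ⊤ := by
        rw [← ofReal_norm_toLp_sq hb, ← ofReal_norm_toLp_sq hs]
        exact ENNReal.add_lt_top.2 ⟨ENNReal.ofReal_lt_top, ENNReal.ofReal_lt_top⟩

/-- The score operator `b ↦ E[b | Z]` and `s ↦ E[s(Z) | α]` are adjoint. -/
lemma integral_mul_adjointScore (hη₀ : η₀ ∈ M.H) {b : A → ℝ} (hbm : Measurable b)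
    (hb : MemLp b 2 (η₀ : Measure A)) {s : Z → ℝ} (hsm : Measurable s)
    (hs : MemLp s 2 (M.law η₀)) :
    ∫ α, b α * M.adjointScore s α ∂(η₀ : Measure A) =
      ∫ z, s z * M.inducedScore (η₀ : Measure A) b z ∂(M.law η₀) := by
  simp only [adjointScore, ← integral_const_mul]
  rw [integral_integral_swap (integrable_mul_mul_f hη₀ hbm hb hsm hs), law_eq,
    integral_withDensity_eq_integral_toReal_smul (M.measurable_mixDensity _)
      (mixDensity_lt_top hη₀)]
  refine integral_congr_ae ?_
  filter_upwards [mixDensity_lt_top hη₀] with z hz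
  have h1 : ∫ α, b α * (s z * (M.f α z : ℝ)) ∂(η₀ : Measure A) =
      s z * ∫ α, (M.f α z : ℝ) * b α ∂(η₀ : Measure A) := by
    rw [← integral_const_mul]
    congr 1; ext α; ring
  simp only [smul_eq_mul, inducedScore]
  rw [h1]
  by_cases h0 : M.mixDensity (η₀ : Measure A) z = 0
  · have h2 : ∀ᵐ α ∂(η₀ : Measure A), (M.f α z : ℝ≥0∞) = 0 :=
      (lintegral_eq_zero_iff (M.measurable_f_left z).coe_nnreal_ennreal).1 h0
    have h3 : ∫ α, (M.f α z : ℝ) * b α ∂(η₀ : Measure A) = 0 :=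
      integral_eq_zero_of_ae (h2.mono fun α hα => by simp [ENNReal.coe_eq_zero.1 hα])
    simp [h3]
  · have : (M.mixDensity (η₀ : Measure A) z).toReal ≠ 0 := ENNReal.toReal_ne_zero.2 ⟨h0, hz.ne⟩
    field_simp

lemma measurable_adjointScore (M : MixtureModel A Z) {s : Z → ℝ} (hsm : Measurable s) :
    Measurable (M.adjointScore s) := by
  have : Measurable fun x : A × Z => s x.2 * (M.f x.1 x.2 : ℝ) :=
    (hsm.comp measurable_snd).mul M.measurable_f.coe_nnreal_real
  exact (this.stronglyMeasurable.integral_prod_right').measurable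

/-- Jensen's inequality for the conditional law of `Z` given `α`. -/
lemma ofReal_adjointScore_sq_le {s : Z → ℝ} (hsm : Measurable s) {α : A} (hα : α ∈ M.supp) :
    ENNReal.ofReal (M.adjointScore s α ^ 2) ≤
      ∫⁻ z, (M.f α z : ℝ≥0∞) * ENNReal.ofReal (s z ^ 2) ∂M.μ := by
  have hfm := (M.measurable_f_right α).coe_nnreal_ennreal
  have hP : IsProbabilityMeasure (M.μ.withDensity fun z => (M.f α z : ℝ≥0∞)) :=
    ⟨by rw [withDensity_apply _ MeasurableSet.univ, Measure.restrict_univ, M.lintegral_f α hα]⟩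
  have e1 : M.adjointScore s α = ∫ z, s z ∂(M.μ.withDensity fun z => (M.f α z : ℝ≥0∞)) := by
    rw [integral_withDensity_eq_integral_toReal_smul hfm (by simp)]
    simp [adjointScore, mul_comm]
  have e2 := lintegral_withDensity_eq_lintegral_mul_non_measurable M.μ hfm (by simp)
    (fun z => ENNReal.ofReal (s z ^ 2))
  simp only [Pi.mul_apply] at e2
  rw [e1, ← e2]
  by_cases htop : ∫⁻ z, ENNReal.ofReal (s z ^ 2)
      ∂(M.μ.withDensity fun z => (M.f α z : ℝ≥0∞)) = ⊤
  · rw [htop]; exact le_top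
  have hs := memLp_two_of_lintegral_lt_top hsm.aestronglyMeasurable (lt_top_iff_ne_top.2 htop)
  rw [← ofReal_norm_toLp_sq hs]
  refine ENNReal.ofReal_le_ofReal ?_
  have h1 : MemLp (fun _ : Z => (1 : ℝ)) 2 (M.μ.withDensity fun z => (M.f α z : ℝ≥0∞)) :=
    memLp_const 1
  have hn : ‖h1.toLp _‖ = 1 := by
    have := norm_toLp_sq h1
    simp only [one_pow, integral_const, probReal_univ, smul_eq_mul, mul_one] at this
    exact (pow_eq_one_iff_of_nonneg (norm_nonneg _) two_ne_zero).1 this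
  have h2 := abs_setIntegral_mul_le hs h1 MeasurableSet.univ
  simp only [mul_one, Measure.restrict_univ, hn] at h2
  rw [← sq_abs]
  exact pow_le_pow_left₀ (abs_nonneg _) h2 2

lemma memLp_adjointScore (hη₀ : η₀ ∈ M.H) {s : Z → ℝ} (hsm : Measurable s)
    (hs : MemLp s 2 (M.law η₀)) : MemLp (M.adjointScore s) 2 (η₀ : Measure A) := by
  refine memLp_two_of_lintegral_lt_top (M.measurable_adjointScore hsm).aestronglyMeasurable ?_
  refine (lintegral_mono_ae ((M.carried η₀ hη₀).mono fun α hα =>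
    ofReal_adjointScore_sq_le hsm hα)).trans_lt ?_
  rw [lintegral_lintegral_f_mul_right hη₀ (by fun_prop), ← ofReal_norm_toLp_sq hs]
  exact ENNReal.ofReal_lt_top

lemma integral_adjointScore (hη₀ : η₀ ∈ M.H) {s : Z → ℝ} (hsm : Measurable s)
    (hs : MemLp s 2 (M.law η₀)) :
    ∫ α, M.adjointScore s α ∂(η₀ : Measure A) = ∫ z, s z ∂(M.law η₀) := by
  have h := integral_mul_adjointScore hη₀ (b := fun _ => 1) measurable_const (memLp_const 1) hsm hs
  simp only [one_mul] at h
  rw [h]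
  exact integral_congr_ae ((inducedScore_one hη₀).mono fun z hz => by simp [hz])

lemma integral_inducedScore (hη₀ : η₀ ∈ M.H) {b : A → ℝ} (hbm : Measurable b)
    (hb : MemLp b 2 (η₀ : Measure A)) :
    ∫ z, M.inducedScore (η₀ : Measure A) b z ∂(M.law η₀) = ∫ α, b α ∂(η₀ : Measure A) := by
  have := isProbabilityMeasure_law M hη₀
  have h := integral_mul_adjointScore hη₀ hbm hb (s := fun _ => 1) measurable_const (memLp_const 1)
  simp only [one_mul] at h
  rw [← h]
  exact integral_congr_ae ((M.carried η₀ hη₀).mono fun α hα => by simp [adjointScore_one hα])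

lemma IsSubmodel.integral_eq_zero {γ : ℝ → ProbabilityMeasure A} {b : Lp ℝ 2 (η₀ : Measure A)}
    (h : M.IsSubmodel η₀ γ b) : ∫ α, b α ∂(η₀ : Measure A) = 0 := by
  obtain ⟨⟨h0, -⟩, hs⟩ := h
  have hbm : Measurable b := (Lp.stronglyMeasurable b).measurable
  subst h0
  exact HasScore.integral_eq_zero (Q := fun t => (γ t : Measure A)) hs hbm (Lp.memLp b)

/-- Along every submodel, the pair of the induced score and the derivative of `φ` given by the
influence function belongs to the space over which the efficiency bound is computed. -/
lemma IsSubmodel.mem_scoreDerivSpace (hη₀ : η₀ ∈ M.H) {φ : ProbabilityMeasure A → ℝ} {r : A → ℝ}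
    (hφ : M.HasInfluenceFunction η₀ φ r) {γ : ℝ → ProbabilityMeasure A}
    {b : Lp ℝ 2 (η₀ : Measure A)} (h : M.IsSubmodel η₀ γ b) :
    ((M.memLp_inducedScore hη₀ (Lp.stronglyMeasurable b).measurable (Lp.memLp b)).toLp _,
      ∫ α, r α * b α ∂(η₀ : Measure A)) ∈ M.scoreDerivSpace η₀ φ := by
  refine Submodule.subset_span ⟨γ, b, h, ?_, hφ.2.2 γ b h⟩
  have h0 : γ 0 = η₀ := h.1.1
  have := isProbabilityMeasure_law M hη₀
  refine @hasScore_congr _ _ (fun t => M.law (γ t)) ?_ _ _ ?_ ?_ (h.hasScore_law hη₀)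
  · simp only [h0]; infer_instance
  · simp only [h0]
    exact (MemLp.coeFn_toLp _).symm
  · obtain ⟨-, ε, hε, hγ⟩ := h.1
    filter_upwards [Ioo_mem_nhdsGT hε] with t ht
    have := isProbabilityMeasure_law M (hγ t ⟨ht.1.le, ht.2⟩)
    infer_instance

/-- A functional with a finite efficiency bound has an influence function in the range of the
adjoint of the score operator: `r(α) = E[s(Z) | α]` for some score function `s`. -/
lemma exists_solvesScoreEq (hη₀ : η₀ ∈ M.H) (hnp : M.Nonparametric η₀)
    {φ : ProbabilityMeasure A → ℝ} {r : A → ℝ} (hφ : M.HasInfluenceFunction η₀ φ r)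
    (hbound : M.efficiencyBound η₀ φ < ⊤) : ∃ s, M.SolvesScoreEq η₀ r s := by
  have := isProbabilityMeasure_law M hη₀
  obtain ⟨hr, hr0, -⟩ := id hφ
  obtain ⟨s₀, hs₀⟩ := exists_inner_eq_of_sq_le (M.scoreDerivSpace η₀ φ)
    (M.efficiencyBound η₀ φ).toReal fun p hp => by
      have h1 : ENNReal.ofReal (p.2 ^ 2) / ENNReal.ofReal (‖p.1‖ ^ 2) ≤ M.efficiencyBound η₀ φ :=
        le_iSup₂_of_le p hp le_rfl
      have hdiv : ENNReal.ofReal (p.2 ^ 2) / ENNReal.ofReal (‖p.1‖ ^ 2) ≤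
          M.efficiencyBound η₀ φ → ENNReal.ofReal (p.2 ^ 2) ≤
          M.efficiencyBound η₀ φ * ENNReal.ofReal (‖p.1‖ ^ 2) :=
        (ENNReal.div_le_iff_le_mul (Or.inr hbound.ne) (Or.inl ENNReal.ofReal_ne_top)).1
      have h2 := hdiv h1
      rw [← ENNReal.ofReal_toReal hbound.ne, ← ENNReal.ofReal_mul ENNReal.toReal_nonneg] at h2
      exact (ENNReal.ofReal_le_ofReal_iff (by positivity)).1 h2
  -- centring does not change the inner products with the scores, which have mean zero
  set m := ∫ z, s₀ z ∂(M.law η₀) with hm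
  set s : Z → ℝ := fun z => s₀ z - m with hs
  have hs₀L : MemLp s₀ 2 (M.law η₀) := Lp.memLp s₀
  have hsm : Measurable s := (Lp.stronglyMeasurable s₀).measurable.sub_const m
  have hsL : MemLp s 2 (M.law η₀) := hs₀L.sub (memLp_const m)
  have hsmean : ∫ z, s z ∂(M.law η₀) = 0 := by
    rw [hs, integral_sub (hs₀L.integrable one_le_two) (integrable_const _)]
    simp [hm]
  have hSL := memLp_adjointScore hη₀ hsm hsL
  have hS0 : ∫ α, M.adjointScore s α ∂(η₀ : Measure A) = 0 := by
    rw [integral_adjointScore hη₀ hsm hsL, hsmean]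
  have hgen : ∀ γ b, M.IsSubmodel η₀ γ b →
      ∫ α, b α * M.adjointScore s α ∂(η₀ : Measure A) = ∫ α, r α * b α ∂(η₀ : Measure A) := by
    intro γ b h
    have hbm : Measurable b := (Lp.stronglyMeasurable b).measurable
    have hg := M.memLp_inducedScore hη₀ hbm (Lp.memLp b)
    have h1 := hs₀ _ (h.mem_scoreDerivSpace hη₀ hφ)
    rw [← Lp.toLp_coeFn s₀ hs₀L, inner_toLp_toLp] at h1
    dsimp only at h1
    rw [integral_mul_adjointScore hη₀ hbm (Lp.memLp b) hsm hsL, ← h1]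
    simp only [hs, sub_mul]
    have hi : Integrable (fun z => s₀ z * M.inducedScore (η₀ : Measure A) b z) (M.law η₀) :=
      hs₀L.integrable_mul hg
    rw [integral_sub hi ((hg.integrable one_le_two).const_mul m), integral_const_mul,
      integral_inducedScore hη₀ hbm (Lp.memLp b), h.integral_eq_zero, mul_zero, sub_zero]
  have hd : MemLp (fun α => r α - M.adjointScore s α) 2 (η₀ : Measure A) := hr.sub hSL
  -- `r - E[s | α]` is orthogonal to the tangent space, hence to itself
  have horth : M.tangentSpace η₀ ≤ (ℝ ∙ hd.toLp _)ᗮ := by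
    refine Submodule.span_le.2 ?_
    rintro b ⟨γ, h⟩
    rw [SetLike.mem_coe, Submodule.mem_orthogonal_singleton_iff_inner_right,
      ← Lp.toLp_coeFn b (Lp.memLp b), inner_toLp_toLp]
    simp only [sub_mul]
    have hi1 : Integrable (fun α => r α * b α) (η₀ : Measure A) := hr.integrable_mul (Lp.memLp b)
    have hi2 : Integrable (fun α => M.adjointScore s α * b α) (η₀ : Measure A) :=
      hSL.integrable_mul (Lp.memLp b)
    rw [integral_sub hi1 hi2, ← hgen γ b h]
    simp [mul_comm]
  have hmean : ∫ α, hd.toLp _ α ∂(η₀ : Measure A) = 0 := by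
    rw [integral_congr_ae hd.coeFn_toLp, integral_sub (hr.integrable one_le_two)
      (hSL.integrable one_le_two), hr0, hS0, sub_zero]
  have hself := (Submodule.topologicalClosure_minimal _ horth
    (Submodule.isClosed_orthogonal _)) (hnp _ hmean)
  rw [Submodule.mem_orthogonal_singleton_iff_inner_right, inner_self_eq_zero,
    Lp.eq_zero_iff_ae_eq_zero] at hself
  refine ⟨s, hsm, hsL, hsmean, ?_⟩
  filter_upwards [hself, hd.coeFn_toLp] with α h1 h2
  rw [h2] at h1
  rw [hr0, sub_zero]
  exact sub_eq_zero.1 h1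

/-- On a set where the model is smooth, `E[s(Z) | α]` is continuous for every solution `s` of the
score equation. -/
lemma SmoothOn.continuousOn_adjointScore {M : MixtureModel ℝ Z} {η₀ : ProbabilityMeasure ℝ}
    {r : ℝ → ℝ} {N : Set ℝ} (h : M.SmoothOn η₀ r N) {s : Z → ℝ} (hs : M.SolvesScoreEq η₀ r s) :
    ContinuousOn (M.adjointScore s) N := by
  intro α hα
  obtain ⟨Γ, hΓ, hΓN, hdom⟩ := h.dominated α hα
  have hlt := hdom s hs
  have hsm := hs.1
  -- for almost every `z` the supremum over `Γ` is one over a countable dense subset, hence measurable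
  obtain ⟨D, hDc, hDd⟩ := TopologicalSpace.exists_countable_dense Γ
  set G : Z → ℝ≥0∞ := fun z => ⨆ a ∈ D, (M.f (a : ℝ) z : ℝ≥0∞) with hG
  have hGm : Measurable G :=
    Measurable.biSup D hDc fun a _ => (M.measurable_f_right a).coe_nnreal_ennreal
  have hle : ∀ᵐ z ∂M.μ, ∀ a ∈ Γ, (M.f a z : ℝ≥0∞) ≤ G z := by
    filter_upwards [h.continuousOn] with z hz a ha
    have hc : Continuous fun x : Γ => (M.f (x : ℝ) z : ℝ≥0∞) :=
      ENNReal.continuous_coe.comp (continuousOn_iff_continuous_domRestrict.1 (hz.mono hΓN))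
    have hclosed : IsClosed {x : Γ | (M.f (x : ℝ) z : ℝ≥0∞) ≤ G z} :=
      isClosed_le hc continuous_const
    have hsub : closure D ⊆ {x : Γ | (M.f (x : ℝ) z : ℝ≥0∞) ≤ G z} :=
      closure_minimal (fun x hx =>
        le_iSup₂ (f := fun (a : Γ) (_ : a ∈ D) => (M.f (a : ℝ) z : ℝ≥0∞)) x hx) hclosed
    exact hsub (hDd.closure_eq ▸ mem_univ (⟨a, ha⟩ : Γ))
  have hGlt : ∫⁻ z, ‖s z‖ₑ * G z ∂M.μ < ⊤ := by
    refine (lintegral_mono fun z => ?_).trans_lt hlt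
    gcongr
    exact iSup₂_le fun a _ => le_iSup₂_of_le (a : ℝ) a.2 le_rfl
  have hbm : Measurable fun z => ‖s z‖ₑ * G z := hsm.enorm.mul hGm
  refine continuousWithinAt_of_dominated (bound := fun z => (‖s z‖ₑ * G z).toReal)
    (Eventually.of_forall fun a =>
      (hsm.mul (M.measurable_f_right a).coe_nnreal_real).aestronglyMeasurable) ?_
    (integrable_toReal_of_lintegral_ne_top hbm.aemeasurable hGlt.ne) ?_
  · filter_upwards [hΓ] with a ha
    filter_upwards [hle, ae_lt_top hbm hGlt.ne] with z hz hzt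
    have : ‖s z * (M.f a z : ℝ)‖ = (‖s z‖ₑ * (M.f a z : ℝ≥0∞)).toReal := by
      simp [ENNReal.toReal_mul]
    rw [this]
    exact ENNReal.toReal_mono hzt.ne (by gcongr; exact hz a ha)
  · filter_upwards [h.continuousOn] with z hz
    exact continuousWithinAt_const.mul
      (NNReal.continuous_coe.continuousAt.comp_continuousWithinAt (hz α hα))

end MixtureModel

/-! ### The influence function of a quantile -/

section QuantileInfluence

lemma memLp_quantileInfluence (τ q d : ℝ) (η : ProbabilityMeasure ℝ) :
    MemLp (quantileInfluence τ q d) 2 (η : Measure ℝ) := by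
  have h : MemLp ((Iio q).indicator fun _ => (1 : ℝ)) 2 (η : Measure ℝ) :=
    (memLp_const 1).indicator measurableSet_Iio
  refine ((h.sub (memLp_const τ)).const_mul (-d⁻¹)).ae_eq (Eventually.of_forall fun x => ?_)
  simp [quantileInfluence, div_eq_mul_inv]
  ring

lemma integral_quantileInfluence_mul {τ q d : ℝ} {η : Measure ℝ} (hq : η {q} = 0) {b : ℝ → ℝ}
    (hb : Integrable b η) :
    ∫ α, quantileInfluence τ q d α * b α ∂η =
      -(∫ α in Iic q, b α ∂η - τ * ∫ α, b α ∂η) / d := by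
  have h1 : ∀ α, quantileInfluence τ q d α * b α =
      (-d⁻¹) * ((Iio q).indicator b α - τ * b α) := fun α => by
    by_cases h : α ∈ Iio q <;> simp [quantileInfluence, h, div_eq_mul_inv] <;> ring
  simp only [h1]
  rw [integral_const_mul, integral_sub (hb.indicator measurableSet_Iio) (hb.const_mul τ),
    integral_const_mul, integral_indicator measurableSet_Iio,
    setIntegral_congr_set (Iio_ae_eq_Iic' hq)]
  ring

/-- The quantile functional is differentiable along every submodel. -/
lemma hasInfluenceFunction_quantile {Z : Type*} [MeasurableSpace Z] (M : MixtureModel ℝ Z)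
    {η₀ : ProbabilityMeasure ℝ} {τ q d : ℝ} (hτ : τ ∈ Ioo (0 : ℝ) 1)
    (hq : q = quantile τ η₀) (hqτ : cdf (η₀ : Measure ℝ) q = τ) (hd0 : 0 < d)
    (hd : HasDerivAt (fun x => cdf (η₀ : Measure ℝ) x) d q) :
    M.HasInfluenceFunction η₀ (quantile τ) (quantileInfluence τ q d) := by
  have hq0 := measure_singleton_eq_zero_of_hasDerivAt_cdf η₀ hd
  refine ⟨memLp_quantileInfluence τ q d η₀, ?_, fun γ b h => ?_⟩
  · have h1 := integral_quantileInfluence_mul (τ := τ) (d := d) hq0 (b := fun _ => 1)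
      (integrable_const 1)
    simp only [mul_one, integral_const, measureReal_restrict_apply MeasurableSet.univ, univ_inter,
      probReal_univ, smul_eq_mul, ← cdf_eq_real, hqτ, sub_self, neg_zero, zero_div] at h1
    exact h1
  · have hbm : Measurable b := (Lp.stronglyMeasurable b).measurable
    have hb := Lp.memLp b
    rw [integral_quantileInfluence_mul hq0 (hb.integrable one_le_two), h.integral_eq_zero, mul_zero,
      sub_zero]
    have h0 : γ 0 = η₀ := h.1.1
    subst h0
    exact hasPathDeriv_quantile h.2 hbm hb hτ hq hqτ hd0 hd

/-- The step function `quantileInfluence τ q d` cannot be made continuous at `q` by a modification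
on a set that `η` does not see, if `η` charges all intervals near `q`. -/
lemma not_exists_continuousOn_eq_quantileInfluence {η : Measure ℝ} {τ q d δ : ℝ} (hd : d ≠ 0)
    (hδ : 0 < δ) (hη : ∀ a c, q - δ ≤ a → c ≤ q + δ → a < c → η (Ioo a c) ≠ 0)
    {supp U : Set ℝ} (hsupp : ∀ᵐ α ∂η, α ∈ supp) (hU : IsOpen U) (hq : q ∈ U ∩ supp) :
    ¬ ∃ g : ℝ → ℝ, ContinuousOn g (U ∩ supp) ∧
      ∀ᵐ α ∂η, α ∈ U ∩ supp → g α = quantileInfluence τ q d α := by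
  rintro ⟨g, hg, hae⟩
  have hgq := hg q hq
  obtain ⟨ρ, hρ, hρU⟩ := Metric.isOpen_iff.1 hU q hq.1
  have hfreq : ∀ a c, q - min δ ρ ≤ a → c ≤ q + min δ ρ → a < c →
      ∃ α ∈ Ioo a c, α ∈ U ∩ supp ∧ g α = quantileInfluence τ q d α := by
    intro a c ha hc hac
    have h1 := hη a c (by linarith [min_le_left δ ρ]) (by linarith [min_le_left δ ρ]) hac
    have h2 : ∃ᵐ α ∂η, α ∈ Ioo a c := by
      rw [Filter.Frequently, ae_iff]
      simpa only [not_not, ofPred_mem_eq] using h1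
    obtain ⟨α, hα, hα1, hα2⟩ := (h2.and_eventually (hsupp.and hae)).exists
    have hαU : α ∈ U := hρU (by
      rw [Metric.mem_ball, Real.dist_eq, abs_lt]
      constructor <;> linarith [min_le_right δ ρ, hα.1, hα.2])
    exact ⟨α, hα, ⟨hαU, hα1⟩, hα2 ⟨hαU, hα1⟩⟩
  have hlim : ∀ v, (∀ ε > 0, ∃ α ∈ Ioo (q - ε) (q + ε), α ∈ U ∩ supp ∧ g α = v) → g q = v := by
    intro v hv
    by_contra hne
    have hev := hgq.eventually (isOpen_ne.mem_nhds hne)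
    obtain ⟨ε, hε, hsub⟩ := Metric.mem_nhdsWithin_iff.1 hev
    obtain ⟨α, hα, hαN, hgα⟩ := hv ε hε
    refine hsub ⟨?_, hαN⟩ hgα
    rw [Metric.mem_ball, Real.dist_eq, abs_lt]
    constructor <;> linarith [hα.1, hα.2]
  have hmin : 0 < min δ ρ := lt_min hδ hρ
  have hleft : g q = -(1 - τ) / d := hlim _ fun ε hε => by
    obtain ⟨α, hα, hαN, hgα⟩ := hfreq (q - min (min δ ρ) ε) q
      (by linarith [min_le_left (min δ ρ) ε]) (by linarith)
      (by linarith [lt_min hmin hε])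
    refine ⟨α, ⟨by linarith [hα.1, min_le_right (min δ ρ) ε], by linarith [hα.2]⟩, hαN, ?_⟩
    rw [hgα, quantileInfluence, indicator_of_mem (mem_Iio.2 hα.2)]
  have hright : g q = -(0 - τ) / d := hlim _ fun ε hε => by
    obtain ⟨α, hα, hαN, hgα⟩ := hfreq q (q + min (min δ ρ) ε) (by linarith)
      (by linarith [min_le_left (min δ ρ) ε]) (by linarith [lt_min hmin hε])
    refine ⟨α, ⟨by linarith [hα.1], by linarith [hα.2, min_le_right (min δ ρ) ε]⟩, hαN, ?_⟩
    rw [hgα, quantileInfluence, indicator_of_notMem (notMem_Iio.2 hα.1.le)]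
  rw [hleft, div_left_inj' hd] at hright
  linarith

/-- A measure with a strictly positive density near `q` charges all intervals there. -/
lemma measure_Ioo_ne_zero_of_density {η : Measure ℝ} {p : ℝ → ℝ} (hp : Measurable p) {q δ : ℝ}
    (hpos : ∀ x ∈ Ioo (q - δ) (q + δ), 0 < p x)
    (hdens : η.restrict (Ioo (q - δ) (q + δ)) =
      (volume.withDensity (fun x => ENNReal.ofReal (p x))).restrict (Ioo (q - δ) (q + δ)))
    {a c : ℝ} (ha : q - δ ≤ a) (hc : c ≤ q + δ) (hac : a < c) : η (Ioo a c) ≠ 0 := by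
  have hsub : Ioo a c ⊆ Ioo (q - δ) (q + δ) := Ioo_subset_Ioo ha hc
  rw [← Measure.restrict_eq_self η hsub, hdens, Measure.restrict_eq_self _ hsub, Ne,
    withDensity_apply_eq_zero hp.ennreal_ofReal]
  have : {x | ENNReal.ofReal (p x) ≠ 0} ∩ Ioo a c = Ioo a c :=
    inter_eq_right.2 fun x hx => (ENNReal.ofReal_pos.2 (hpos x (hsub hx))).ne'
  rw [this, Real.volume_Ioo]
  simpa using hac

end QuantileInfluence

theorem corollary2 {Z : Type*} [MeasurableSpace Z] (M : MixtureModel ℝ Z)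
    (η₀ : ProbabilityMeasure ℝ) (hη₀ : η₀ ∈ M.H) (hnp : M.Nonparametric η₀)
    (τ : ℝ) (hτ : τ ∈ Ioo (0 : ℝ) 1)
    -- `q` is the `τ`-quantile of `η₀`
    (q : ℝ) (hq : q = quantile τ η₀) (hqτ : cdf (η₀ : Measure ℝ) q = τ)
    -- near `q`, `η₀` has the strictly positive Lebesgue density `p`, which at `q` is the
    -- derivative of the distribution function
    (p : ℝ → ℝ) (hp : Measurable p) (δ : ℝ) (hδ : 0 < δ)
    (hpos : ∀ x ∈ Ioo (q - δ) (q + δ), 0 < p x)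
    (hdens : (η₀ : Measure ℝ).restrict (Ioo (q - δ) (q + δ)) =
      (volume.withDensity (fun x => ENNReal.ofReal (p x))).restrict (Ioo (q - δ) (q + δ)))
    (hderiv : HasDerivAt (fun x => cdf (η₀ : Measure ℝ) x) (p q) q)
    -- `N` is an open subset of the heterogeneity space on which the model is smooth
    (N U : Set ℝ) (hU : IsOpen U) (hN : N = U ∩ M.supp) (hqN : q ∈ N)
    (hsmooth : M.SmoothOn η₀ (quantileInfluence τ q (p q)) N) :
    -- the quantile functional is differentiable with the stated influence function,
    M.HasInfluenceFunction η₀ (quantile τ) (quantileInfluence τ q (p q)) ∧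
    -- which is discontinuous on `N`,
    (¬ ∃ g : ℝ → ℝ, ContinuousOn g N ∧
      ∀ᵐ α ∂(η₀ : Measure ℝ), α ∈ N → g α = quantileInfluence τ q (p q) α) ∧
    -- and the `τ`-quantile has an infinite efficiency bound: it is not regularly identified
    M.efficiencyBound η₀ (quantile τ) = ⊤ ∧
    ¬ M.RegularlyIdentified η₀ (quantile τ) := by
  have hd0 : 0 < p q := hpos q ⟨by linarith, by linarith⟩
  have hφ := hasInfluenceFunction_quantile M hτ hq hqτ hd0 hderiv
  have hdisc : ¬ ∃ g : ℝ → ℝ, ContinuousOn g N ∧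
      ∀ᵐ α ∂(η₀ : Measure ℝ), α ∈ N → g α = quantileInfluence τ q (p q) α := by
    subst hN
    exact not_exists_continuousOn_eq_quantileInfluence hd0.ne' hδ
      (fun a c => measure_Ioo_ne_zero_of_density hp hpos hdens) (M.carried η₀ hη₀) hU hqN
  have hinf : M.efficiencyBound η₀ (quantile τ) = ⊤ := by
    by_contra hne
    obtain ⟨s, hs⟩ := MixtureModel.exists_solvesScoreEq hη₀ hnp hφ (lt_top_iff_ne_top.2 hne)
    refine hdisc ⟨M.adjointScore s, hsmooth.continuousOn_adjointScore hs, ?_⟩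
    filter_upwards [hs.2.2.2] with α hα _
    rw [hφ.2.1, sub_zero] at hα
    exact hα.symm
  exact ⟨hφ, hdisc, hinf, fun h => h.2.ne hinf⟩
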